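/- Let $\mathbb F$ be the algebraic closure of $\mathbb Q(q)$, put $[x]=\frac{q^x-q^{-x}}{q-q^{-1}}$ for $x\in\mathbb Z$, $[k]!=[1]\cdots[k]$, $\genfrac[]{0pt}{}{x}{k}=\frac{[x][x-1]\cdots[x-k+1]}{[k]!}$ for $x\in\mathbb Z$, $k\in\mathbb N$, and $X^{(k)}=X^k/[k]!$. Let $\mathbf U=\mathbf U(\mathfrak{sl}_3)$ be the Drinfeld–Jimbo quantum group over $\mathbb F$ with generators $E_i,F_i,K_i^{\pm1}$ $(i=1,2)$, let $\tau$ be the transposition of $\{1,2\}$, and for $\varsigma_1,\varsigma_2\in\mathbb F$ let $\mathbf U^\imath\subset\mathbf U$ be the subalgebra generated by $B_i=F_i+\varsigma_iE_{\tau i}K_i^{-1}$ and $k_i=K_iK_{\tau i}^{-1}$ $(i=1,2)$ (the quasi-split iquantum group of type AIII). Let $m,n\in\mathbb N$, let $L(m,n)$ be the simple $\mathbf U$-module of highest weight $m\omega_1+n\omega_2$ (so $K_1,K_2$ act on a highest weight vector by $q^m,q^n$), viewed also as a $\mathbf U^\imath$-module, and let $\eta$ be a highest weight vector of $L(m,n)$.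 The canonical basis of $\mathbf U^-$ is the set $\{F_1^{(a)}F_2^{(b)}F_1^{(c)},\,F_2^{(a)}F_1^{(b)}F_2^{(c)}\mid a,b,c\in\mathbb N,\ b\ge a+c\}$, and the canonical basis of $L(m,n)$ is the set of all nonzero $x\eta$ with $x$ in the canonical basis of $\mathbf U^-$. 1. For all $a,b,c\in\mathbb N$ with $b\ge a+c$: $B_1^{(a)}B_2^{(b)}B_1^{(c)}\eta=0$ if and only if $F_1^{(a)}F_2^{(b)}F_1^{(c)}\eta=0$. 2. For all $a,c\in\mathbb N$: $B_1^{(a)}B_2^{(a+c)}B_1^{(c)}\eta=B_2^{(c)}B_1^{(a+c)}B_2^{(a)}\eta$. 3. Modulo this identification for $b=a+c$, the set $$\{B_1^{(a)}B_2^{(b)}B_1^{(c)}\eta\mid c\le m,\ a\le b-c\le n\}\cup\{B_2^{(c)}B_1^{(b)}B_2^{(a)}\eta\mid a\le n,\ c\le b-a\le m\}$$ is an $\mathbb F$-basis of $L(m,n)$ (the quasi icanonical basis). The same set with each $B_i$ replaced by $F_i$, under the same identification, is the canonical basis of $L(m,n)$ and is an $\mathbb F$-basis. 4. With this common indexing the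 transition matrix from the quasi icanonical basis to the canonical basis is unitriangular: for $i\in\{1,2\}$, the vector $B_i^{(a)}B_{\tau i}^{(b)}B_i^{(c)}\eta$ is the sum of $F_i^{(a)}F_{\tau i}^{(b)}F_i^{(c)}\eta$ and a linear combination of canonical basis elements $F_i^{(a')}F_{\tau i}^{(b')}F_i^{(c')}\eta$ with $b'-a'-c'=b-a-c$, $a'\le a$, $c'\le c$, $(a',c')\ne(a,c)$. 5. The inverse transition matrix is explicit. For all $a,c,r\in\mathbb N$, $$F_1^{(a)}F_2^{(a+c+r)}F_1^{(c)}\eta=\sum_{t=0}^{a}\sum_{l=0}^{c}(-1)^{a-t+c-l}\,q^{(a-t)(-2m-3-2r+2l+a-t)/2+(c-l)(-2n-3+2r+2a+c-l)/2}\,\varsigma_1^{a-t}\varsigma_2^{c-l}\genfrac[]{0pt}{}{n-r-t}{a-t}\genfrac[]{0pt}{}{m-l}{c-l}\,B_1^{(t)}B_2^{(t+l+r)}B_1^{(l)}\eta,$$ and the same formula holds with the indices $1,2$ and the numbers $m,n$ interchanged. -/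

import Mathlib

/-! ## The ground field and quantum integers -/

namespace QSL3

/-- The algebraic closure of the field of rational functions in one variable over `ℚ`. -/
noncomputable abbrev 𝔽 : Type := AlgebraicClosure (RatFunc ℚ)

/-- The indeterminate `q`, as an element of `𝔽`. -/
noncomputable def q : 𝔽 := algebraMap (RatFunc ℚ) 𝔽 RatFunc.X

/-- The quantum integer `[x] = (q ^ x - q ^ (-x)) / (q - q⁻¹)`, for `x : ℤ`. -/
noncomputable def qInt (x : ℤ) : 𝔽 := (q ^ x - q ^ (-x)) / (q - q⁻¹)

/-- The quantum factorial `[k]!`. -/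
noncomputable def qFactorial (k : ℕ) : 𝔽 := ∏ s ∈ Finset.range k, qInt ((s : ℤ) + 1)

/-- The quantum binomial coefficient with arbitrary integer top,
`[x] [x - 1] ⋯ [x - k + 1] / [k]!`. -/
noncomputable def qBinom (x : ℤ) (k : ℕ) : 𝔽 :=
  (∏ s ∈ Finset.range k, qInt (x - (s : ℤ))) / qFactorial k

/-- The divided power `x ^ k / [k]!` in an `𝔽`-algebra. -/
noncomputable def dividedPow {A : Type*} [Ring A] [Algebra 𝔽 A] (x : A) (k : ℕ) : A :=
  (qFactorial k)⁻¹ • x ^ k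

/-! ## The quantum group `U(sl₃)`

The simple roots are indexed by `Fin 2`: the index `0` stands for the first simple root and the
index `1` for the second. -/

/-- The nontrivial diagram involution. -/
def tau (i : Fin 2) : Fin 2 := 1 - i

/-- The Cartan matrix of `sl₃`. -/
def cartan (i j : Fin 2) : ℤ := if i = j then 2 else -1

/-- Generators of `U(sl₃)`; `Kinv i` is the inverse of `K i`. -/
inductive Gen : Type
  | E (i : Fin 2)
  | F (i : Fin 2)
  | K (i : Fin 2)
  | Kinv (i : Fin 2)

/-- A generator as an element of the free algebra. -/
noncomputable abbrev gen (x : Gen) : FreeAlgebra 𝔽 Gen := FreeAlgebra.ι 𝔽 x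

/-- The defining relations of the Drinfeld–Jimbo quantum group `U(sl₃)`. -/
inductive Rel : FreeAlgebra 𝔽 Gen → FreeAlgebra 𝔽 Gen → Prop
  | K_mul_Kinv (i : Fin 2) : Rel (gen (.K i) * gen (.Kinv i)) 1
  | Kinv_mul_K (i : Fin 2) : Rel (gen (.Kinv i) * gen (.K i)) 1
  | K_comm (i j : Fin 2) : Rel (gen (.K i) * gen (.K j)) (gen (.K j) * gen (.K i))
  | K_E (i j : Fin 2) :
      Rel (gen (.K i) * gen (.E j)) (q ^ cartan i j • (gen (.E j) * gen (.K i)))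
  | K_F (i j : Fin 2) :
      Rel (gen (.K i) * gen (.F j)) (q ^ (-cartan i j) • (gen (.F j) * gen (.K i)))
  | E_F_same (i : Fin 2) :
      Rel (gen (.E i) * gen (.F i) - gen (.F i) * gen (.E i))
        ((q - q⁻¹)⁻¹ • (gen (.K i) - gen (.Kinv i)))
  | E_F_ne (i j : Fin 2) (h : i ≠ j) :
      Rel (gen (.E i) * gen (.F j) - gen (.F j) * gen (.E i)) 0
  | serre_E (i j : Fin 2) (h : i ≠ j) :
      Rel (dividedPow (gen (.E i)) 2 * gen (.E j) - gen (.E i) * gen (.E j) * gen (.E i)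
        + gen (.E j) * dividedPow (gen (.E i)) 2) 0
  | serre_F (i j : Fin 2) (h : i ≠ j) :
      Rel (dividedPow (gen (.F i)) 2 * gen (.F j) - gen (.F i) * gen (.F j) * gen (.F i)
        + gen (.F j) * dividedPow (gen (.F i)) 2) 0

/-- The quantum group `U(sl₃)` over `𝔽`. -/
abbrev U : Type := RingQuot Rel

/-- The image in `U(sl₃)` of a generator. -/
noncomputable def U.of (x : Gen) : U := RingQuot.mkAlgHom 𝔽 Rel (gen x)

/-- The Chevalley generator `E_i`. -/
noncomputable def E (i : Fin 2) : U := U.of (.E i)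

/-- The Chevalley generator `F_i`. -/
noncomputable def F (i : Fin 2) : U := U.of (.F i)

/-- The element `K_i`. -/
noncomputable def K (i : Fin 2) : U := U.of (.K i)

/-- The element `K_i⁻¹`. -/
noncomputable def Kinv (i : Fin 2) : U := U.of (.Kinv i)

/-! ## The quasi-split iquantum group of type AIII in `U(sl₃)` -/

/-- The element `F_i + ς_i E_{τ i} K_i⁻¹` of `U(sl₃)`. -/
noncomputable def BU (ς : Fin 2 → 𝔽) (i : Fin 2) : U := F i + ς i • (E (tau i) * Kinv i)

/-- The element `k_i = K_i K_{τ i}⁻¹` of `U(sl₃)`. -/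
noncomputable def kU (i : Fin 2) : U := K i * Kinv (tau i)

/-- The iquantum group with parameter `ς`: the subalgebra of `U(sl₃)` generated by all `B_i`
and `k_i`. -/
noncomputable def iU (ς : Fin 2 → 𝔽) : Subalgebra 𝔽 U :=
  Algebra.adjoin 𝔽 (Set.range (BU ς) ∪ Set.range kU)

/-- The generator `B_i` of the iquantum group. -/
noncomputable def B (ς : Fin 2 → 𝔽) (i : Fin 2) : iU ς :=
  ⟨BU ς i, Algebra.subset_adjoin (Or.inl ⟨i, rfl⟩)⟩

/-- For a pair of elements `X 0`, `X 1` of an algebra, the product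
`(X i)^(a) (X (τ i))^(b) (X i)^(c)` of divided powers. -/
noncomputable def triple {A : Type*} [Ring A] [Algebra 𝔽 A] (X : Fin 2 → A)
    (i : Fin 2) (a b c : ℕ) : A :=
  dividedPow (X i) a * dividedPow (X (tau i)) b * dividedPow (X i) c

/-! ## Highest weight vectors and the canonical basis -/

/-- The coordinates `m`, `n` of the weight `m ω₁ + n ω₂`. -/
def wt (m n : ℕ) : Fin 2 → ℕ := ![m, n]

/-- `η` is a highest weight vector of weight `m ω₁ + n ω₂`. A simple `U(sl₃)`-module that contains
such a vector is (up to isomorphism) the module `L(m, n)`. -/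
structure IsHighestWeightVector {V : Type*} [AddCommGroup V] [Module 𝔽 V] [Module U V]
    (m n : ℕ) (η : V) : Prop where
  ne_zero : η ≠ 0
  E_smul : ∀ i, E i • η = 0
  K_smul : ∀ i, K i • η = q ^ wt m n i • η

/-- The canonical basis of `U⁻(sl₃)`: the elements `F_1^(a) F_2^(b) F_1^(c)` and
`F_2^(a) F_1^(b) F_2^(c)` with `a + c ≤ b`. -/
def canonicalBasisInfinity : Set U :=
  {x | ∃ (i : Fin 2) (a b c : ℕ), a + c ≤ b ∧ x = triple F i a b c}

/-- The canonical basis of the simple module with highest weight vector `η`: all nonzero vectors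
`x η`, where `x` runs through the canonical basis of `U⁻(sl₃)`. -/
def canonicalBasis {V : Type*} [AddCommGroup V] [Module U V] (η : V) : Set V :=
  {v | v ≠ 0 ∧ ∃ x ∈ canonicalBasisInfinity, v = x • η}

/-- The common index set of the canonical basis and of the quasi icanonical basis of `L(m, n)`.
The index `(i, a, b, c)` belongs to `(X i)^(a) (X (τ i))^(b) (X i)^(c) η`; for `i = 1` (the second
simple root) the case `b = a + c` is left out, as there the two families coincide. -/
@[ext]
structure CBIndex (m n : ℕ) : Type where
  i : Fin 2
  a : ℕ
  b : ℕ
  c : ℕ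
  c_le : c ≤ wt m n i
  add_le : a + c ≤ b
  le_add : b ≤ c + wt m n (tau i)
  lt_of_one : i = 1 → a + c < b

/-- The triangularity order: indices are comparable only if they lie in the same family and
have the same value of `b - a - c`, and then are compared through `a` and `c`. -/
instance (m n : ℕ) : PartialOrder (CBIndex m n) where
  le x y := x.i = y.i ∧ x.b - x.a - x.c = y.b - y.a - y.c ∧ x.a ≤ y.a ∧ x.c ≤ y.c
  le_refl x := ⟨rfl, rfl, le_rfl, le_rfl⟩
  le_trans x y z h h' := ⟨h.1.trans h'.1, h.2.1.trans h'.2.1, h.2.2.1.trans h'.2.2.1,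
    h.2.2.2.trans h'.2.2.2⟩
  le_antisymm x y h h' := by
    have hx := x.add_le
    have hy := y.add_le
    obtain ⟨h1, h2, h3, h4⟩ := h
    obtain ⟨-, -, h5, h6⟩ := h'
    exact CBIndex.ext h1 (by omega) (by omega) (by omega)

/-- The set of all `B_1^(a) B_2^(b) B_1^(c) η` with `c ≤ m`, `a ≤ b - c ≤ n`, and all
`B_2^(c) B_1^(b) B_2^(a) η` with `a ≤ n`, `c ≤ b - a ≤ m`. -/
def quasiICanonicalSet {V : Type*} [AddCommGroup V] [Module U V] (ς : Fin 2 → 𝔽)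
    (m n : ℕ) (η : V) : Set V :=
  {v | ∃ a b c : ℕ, c ≤ m ∧ a + c ≤ b ∧ b ≤ c + n ∧ v = triple (B ς) 0 a b c • η} ∪
  {v | ∃ a b c : ℕ, a ≤ n ∧ a + c ≤ b ∧ b ≤ a + m ∧ v = triple (B ς) 1 c b a • η}

/-- The coefficient
`(-1)^(a-t+c-l) q^((a-t)(-2m-3-2r+2l+a-t)/2 + (c-l)(-2n-3+2r+2a+c-l)/2) s^(a-t) s'^(c-l)`
`[n-r-t, a-t] [m-l, c-l]`, used for `t ≤ a` and `l ≤ c` only. Both divisions by two in the exponent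
are exact. -/
noncomputable def inverseCoeff (m n : ℕ) (s s' : 𝔽) (a c r t l : ℕ) : 𝔽 :=
  (-1) ^ (a - t + (c - l)) *
    q ^ (((a : ℤ) - t) * (-2 * m - 3 - 2 * r + 2 * l + a - t) / 2 +
      ((c : ℤ) - l) * (-2 * n - 3 + 2 * r + 2 * a + c - l) / 2) *
    s ^ (a - t) * s' ^ (c - l) *
    qBinom ((n : ℤ) - r - t) (a - t) * qBinom ((m : ℤ) - l) (c - l)

end QSL3

/-!
Write `x = F_i`, `y = F_{τ i}`, `λ = m ω₁ + n ω₂`, and let `d_i(a, b, c)` be the vector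
`F_i^(a) F_{τ i}^(b) F_i^(c) η`.

The canonical basis. The Serre relations give `x^(a) y^(a+c) x^(c) = y^(c) x^(a+c) y^(a)`
(`IsSerrePair.dividedPow_triple_eq`) and show that the span of the monomials with `a + c ≤ b` is
stable under left multiplication by `F_1` and `F_2` (`F_mul_triple`). A simple module is generated
from a primitive vector by the `F_i` alone (`eq_top_of_primitive`). Hence the vectors `d_i(a, b, c)`
span `L(m, n)`, and a primitive vector of weight lower than `λ` is zero. The latter gives
`d_i(a, b, c) = 0` unless `c ≤ λ_i` and `b ≤ c + λ_{τ i}`. For the linear independence of the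
remaining vectors (`IsHighestWeightVector.linearIndependent`), note that a weight space
`λ - p α_i - s α_{τ i}` with `p ≤ s` only meets the family `d_i(p - c, s, c)`. If `p < s`, then
`E_{τ i}` multiplies these vectors by nonzero scalars and lowers `s`. If `p = s`, the family can be
read in two ways, and applying `E_i` and `E_{τ i}` gives two linear relations between consecutive
coefficients, with determinant `[x+1][y+1] - [x][y] = [x+y+1] ≠ 0`. This is an induction on `p + s`
(`IsHighestWeightVector.eq_zero_of_sum_triple`).

The transition. The summands of `B_i = F_i + ς_i E_{τ i} K_i⁻¹` `q`-commute, so `B_i^(a)` expands by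
the quantum binomial formula (`dividedPow_add`) and `F_i^(a)` by its inverse
(`dividedPow_eq_sum_dividedPow_add`). Powers of `E_{τ i} K_i⁻¹` act on `F_{τ i}^(b) v` by explicit
scalars when `E_{τ i} v = 0` (`dividedPow_EKinv_smul`). Applying this to the middle and then to the
left factor gives closed formulas in both directions
(`IsHighestWeightVector.triple_BU_smul`, `IsHighestWeightVector.triple_F_smul`). The coefficients of
the first are unitriangular and, for `b = a + c`, symmetric under the exchange of the two simple
roots; the vanishing statement, the identification of the two families and the basis property of the
`B`-monomials follow.
-/

namespace QSL3

/-! ### Quantum integers and divided powers -/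

/-- Takes precedence over the instance that comes from `Algebra ℕ (RatFunc ℚ)`, for which scalar
towers are not found. -/
noncomputable instance algebraNat : Algebra ℕ 𝔽 := Semiring.toNatAlgebra

/-- Takes precedence over the instance that comes from `Algebra ℤ (RatFunc ℚ)`, for which scalar
towers are not found. -/
noncomputable instance algebraInt : Algebra ℤ 𝔽 := Ring.toIntAlgebra _

theorem q_ne_zero : q ≠ 0 := by
  simp [q, RatFunc.X_ne_zero]

theorem q_pow_ne_one {k : ℕ} (hk : k ≠ 0) : q ^ k ≠ 1 := by
  intro h
  rw [q, ← map_pow, ← map_one (algebraMap (RatFunc ℚ) 𝔽)] at h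
  have h1 := (algebraMap (RatFunc ℚ) 𝔽).injective h
  rw [← RatFunc.algebraMap_X, ← map_pow, ← map_one (algebraMap (Polynomial ℚ) (RatFunc ℚ))] at h1
  have h2 := congrArg Polynomial.natDegree (RatFunc.algebraMap_injective ℚ h1)
  rw [Polynomial.natDegree_X_pow, Polynomial.natDegree_one] at h2
  exact hk h2

theorem q_zpow_ne_one {x : ℤ} (hx : x ≠ 0) : q ^ x ≠ 1 := by
  obtain ⟨k, rfl | rfl⟩ := Int.eq_nat_or_neg x
  · rw [zpow_natCast]
    exact q_pow_ne_one (by simpa using hx)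
  · rw [zpow_neg, zpow_natCast, ne_eq, inv_eq_one]
    exact q_pow_ne_one (by simpa using hx)

/-- The element `q` is not a root of unity. -/
theorem q_zpow_injective : Function.Injective fun x : ℤ => q ^ x := by
  intro x y h
  by_contra hxy
  refine q_zpow_ne_one (sub_ne_zero.mpr hxy) ?_
  have h' : q ^ x = q ^ y := h
  rw [zpow_sub₀ q_ne_zero, h', div_self (zpow_ne_zero _ q_ne_zero)]

theorem zpow_sub_zpow_neg_ne_zero {x : ℤ} (hx : x ≠ 0) : q ^ x - q ^ (-x) ≠ 0 := by
  rw [sub_ne_zero]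
  intro h
  have := q_zpow_injective h
  omega

theorem q_sub_inv_ne_zero : q - q⁻¹ ≠ 0 := by
  simpa using zpow_sub_zpow_neg_ne_zero one_ne_zero

theorem qInt_ne_zero {x : ℤ} (hx : x ≠ 0) : qInt x ≠ 0 :=
  div_ne_zero (zpow_sub_zpow_neg_ne_zero hx) q_sub_inv_ne_zero

@[simp] theorem qInt_zero : qInt 0 = 0 := by simp [qInt]

@[simp] theorem qInt_one : qInt 1 = 1 := by
  simpa [qInt] using div_self q_sub_inv_ne_zero

theorem qInt_add (x y : ℤ) : qInt (x + y) = q ^ y * qInt x + q ^ (-x) * qInt y := by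
  have h := q_ne_zero
  rw [qInt, qInt, qInt, mul_div_assoc', mul_div_assoc', ← add_div]
  congr 1
  rw [mul_sub, mul_sub, ← zpow_add₀ h, ← zpow_add₀ h, ← zpow_add₀ h, ← zpow_add₀ h]
  rw [show y + x = x + y by ring, show -x + y = y + -x by ring, show -x + -y = -(x + y) by ring]
  ring

/-- All relations between products of two quantum integers used below are instances of this one or
of `qInt_succ_mul_succ_sub`. -/
theorem qInt_mul_sub_mul (x y : ℤ) :
    qInt x * qInt y - qInt (x - 1) * qInt (y + 1) = qInt (y - x + 1) := by
  have h := q_ne_zero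
  have h1 := q_sub_inv_ne_zero
  simp only [qInt]
  rw [div_mul_div_comm, div_mul_div_comm, ← sub_div, div_eq_div_iff (mul_ne_zero h1 h1) h1]
  rw [← mul_assoc]
  congr 1
  simp only [neg_add, neg_sub, zpow_add₀ h, zpow_sub₀ h, zpow_neg, zpow_one]
  have hx := zpow_ne_zero x h
  have hy := zpow_ne_zero y h
  generalize q ^ x = X at *
  generalize q ^ y = Y at *
  field_simp
  ring

theorem qInt_neg (x : ℤ) : qInt (-x) = -qInt x := by
  rw [qInt, qInt, neg_neg, ← neg_sub, neg_div]

theorem qInt_succ_mul_succ_sub (x y : ℤ) :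
    qInt (x + 1) * qInt (y + 1) - qInt x * qInt y = qInt (x + y + 1) := by
  have h := qInt_mul_sub_mul (x + 1) (-(y + 1))
  rw [show x + 1 - 1 = x by ring, show -(y + 1) + 1 = -y by ring,
    show -(y + 1) - (x + 1) + 1 = -(x + y + 1) by ring] at h
  simp only [qInt_neg] at h
  linear_combination -h

theorem qFactorial_succ (k : ℕ) : qFactorial (k + 1) = qInt (k + 1) * qFactorial k := by
  rw [qFactorial, Finset.prod_range_succ, mul_comm, qFactorial]

theorem qInt_natCast_add_one_ne_zero (k : ℕ) : qInt ((k : ℤ) + 1) ≠ 0 :=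
  qInt_ne_zero (by omega)

section DividedPower

variable {A : Type*} [Ring A] [Algebra 𝔽 A]

@[simp] theorem dividedPow_zero (x : A) : dividedPow x 0 = 1 := by
  simp [dividedPow, qFactorial]

@[simp] theorem dividedPow_one (x : A) : dividedPow x 1 = x := by
  simp [dividedPow, qFactorial]

theorem mul_dividedPow (x : A) (k : ℕ) :
    x * dividedPow x k = qInt (k + 1) • dividedPow x (k + 1) := by
  rw [dividedPow, dividedPow, qFactorial_succ, smul_smul, mul_inv,
    mul_inv_cancel_left₀ (qInt_natCast_add_one_ne_zero k), pow_succ', mul_smul_comm]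

theorem dividedPow_mul (x : A) (k : ℕ) :
    dividedPow x k * x = qInt (k + 1) • dividedPow x (k + 1) := by
  rw [← mul_dividedPow, dividedPow, mul_smul_comm, smul_mul_assoc, ← pow_succ, ← pow_succ']

theorem dividedPow_succ (x : A) (k : ℕ) :
    dividedPow x (k + 1) = (qInt (k + 1))⁻¹ • (x * dividedPow x k) := by
  rw [mul_dividedPow, inv_smul_smul₀ (qInt_natCast_add_one_ne_zero k)]

theorem map_dividedPow {A' : Type*} [Ring A'] [Algebra 𝔽 A'] (φ : A →ₐ[𝔽] A') (x : A) (k : ℕ) :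
    φ (dividedPow x k) = dividedPow (φ x) k := by
  rw [dividedPow, dividedPow, map_smul, map_pow]

end DividedPower

/-! ### Monomials in two elements satisfying the quantum Serre relations -/

/-- The quantum Serre relations between two elements `x`, `y` of an `𝔽`-algebra. -/
structure IsSerrePair {A : Type*} [Ring A] [Algebra 𝔽 A] (x y : A) : Prop where
  left : dividedPow x 2 * y - x * y * x + y * dividedPow x 2 = 0
  right : dividedPow y 2 * x - y * x * y + x * dividedPow y 2 = 0

namespace IsSerrePair

variable {A : Type*} [Ring A] [Algebra 𝔽 A] {x y : A}

theorem symm (h : IsSerrePair x y) : IsSerrePair y x := ⟨h.right, h.left⟩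

open MulOpposite in
theorem op_dividedPow (x : A) (k : ℕ) : dividedPow (op x) k = op (dividedPow x k) := by
  rw [dividedPow, dividedPow, op_smul, op_pow]

open MulOpposite in
/-- The Serre relations are invariant under reversing products, which gives the mirror images of the
identities below. -/
theorem op (h : IsSerrePair x y) : IsSerrePair (op x) (op y) := by
  constructor
  · simp only [op_dividedPow, ← op_mul, ← op_sub, ← op_add]
    rw [← op_zero, ← h.left]
    congr 1
    rw [← mul_assoc]
    abel
  · simp only [op_dividedPow, ← op_mul, ← op_sub, ← op_add]
    rw [← op_zero, ← h.right]
    congr 1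
    rw [← mul_assoc]
    abel

/-- The Serre relation of degree two in `y`, with powers in place of divided powers. -/
theorem mul_mul_eq (h : IsSerrePair x y) :
    y * (y * x) = qInt 2 • (y * (x * y)) - x * (y * y) := by
  have h2 : y * y = qInt 2 • dividedPow y 2 := by
    simpa using mul_dividedPow y 1
  rw [← mul_assoc, h2, smul_mul_assoc, mul_smul_comm, ← smul_sub, ← mul_assoc]
  congr 1
  linear_combination (norm := module) h.right

/-- The Serre relation with an arbitrary divided power of `y`. -/
theorem dividedPow_succ_mul (h : IsSerrePair x y) (b : ℕ) :
    dividedPow y (b + 1) * x =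
      y * (x * dividedPow y b) - qInt b • (x * dividedPow y (b + 1)) := by
  induction b with
  | zero => simp
  | succ b ih =>
    have hs := qInt_mul_sub_mul 2 ((b : ℤ) + 1)
    rw [show (2 : ℤ) - 1 = 1 by norm_num, show (b : ℤ) + 1 - 2 + 1 = b by ring, qInt_one] at hs
    have h1 := mul_dividedPow y b
    have h2 := mul_dividedPow y (b + 1)
    have h3 : y * (y * (x * dividedPow y b)) =
        (qInt 2 * qInt (b + 1)) • (y * (x * dividedPow y (b + 1)))
          - (qInt (b + 1) * qInt ((b + 1 : ℕ) + 1)) • (x * dividedPow y (b + 1 + 1)) := by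
      have := congrArg (· * dividedPow y b) h.mul_mul_eq
      simp only [sub_mul, smul_mul_assoc, mul_assoc, h1, h2, mul_smul_comm, smul_smul] at this
      exact this
    have h4 := congrArg (· * x) h2
    simp only [smul_mul_assoc, mul_assoc, ih, mul_sub, mul_smul_comm, h3] at h4
    refine smul_right_injective A (qInt_natCast_add_one_ne_zero (b + 1)) ?_
    push_cast at *
    rw [show (b : ℤ) + 1 + 1 = b + 2 by ring] at *
    linear_combination (norm := module) -h4 + hs • (y * (x * dividedPow y (b + 1)))

theorem mul_dividedPow_succ (h : IsSerrePair x y) (b : ℕ) :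
    x * dividedPow y (b + 1) =
      dividedPow y b * x * y - qInt b • (dividedPow y (b + 1) * x) := by
  have := congrArg MulOpposite.unop (h.op.dividedPow_succ_mul b)
  simpa [op_dividedPow] using this

/-- Rewrites `y x^(a+1) y^(b)` in monomials whose power of `y` is a single block. -/
theorem mul_dividedPow_mul_dividedPow (h : IsSerrePair x y) (a b : ℕ) :
    y * dividedPow x (a + 1) * dividedPow y b =
      qInt ((b : ℤ) - a) • (dividedPow x (a + 1) * dividedPow y (b + 1)) +
        dividedPow x a * dividedPow y (b + 1) * x := by
  have hs := qInt_mul_sub_mul ((a : ℤ) + 1) b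
  rw [show (a : ℤ) + 1 - 1 = a by ring, show (b : ℤ) - (a + 1) + 1 = b - a by ring] at hs
  have h1 := congrArg (· * dividedPow y (b + 1)) (dividedPow_mul x a)
  have h2 := congrArg (dividedPow x a * ·) (h.dividedPow_succ_mul b)
  rw [h.symm.mul_dividedPow_succ a]
  simp only [sub_mul, smul_mul_assoc, mul_assoc, mul_dividedPow, mul_smul_comm, mul_sub,
    smul_smul] at h1 h2 ⊢
  linear_combination (norm := module)
    qInt b • h1 - h2 + hs • (dividedPow x (a + 1) * dividedPow y (b + 1))

theorem dividedPow_mul_dividedPow_mul (h : IsSerrePair x y) (a b : ℕ) :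
    dividedPow y b * dividedPow x (a + 1) * y =
      qInt ((b : ℤ) - a) • (dividedPow y (b + 1) * dividedPow x (a + 1)) +
        x * dividedPow y (b + 1) * dividedPow x a := by
  have := congrArg MulOpposite.unop (h.op.mul_dividedPow_mul_dividedPow a b)
  simpa [op_dividedPow, mul_assoc] using this

/-- The two families of monomials of the canonical basis of `U⁻` coincide for `b = a + c`. In the
induction on `p = a + c`, the identity of level `p`, multiplied by `y` from the left and by `x` from
the right, is a relation between the identities of level `p + 1` for `a + 1` and for `a`. -/
theorem dividedPow_triple_eq (h : IsSerrePair x y) (p : ℕ) : ∀ a c : ℕ, a + c = p →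
    dividedPow x a * dividedPow y p * dividedPow x c =
      dividedPow y c * dividedPow x p * dividedPow y a := by
  induction p with
  | zero =>
    intro a c hac
    obtain ⟨rfl, rfl⟩ : a = 0 ∧ c = 0 := by omega
    simp
  | succ p ihp =>
    intro a
    induction a with
    | zero =>
      intro c hc
      obtain rfl : c = p + 1 := by omega
      simp
    | succ a iha =>
      intro c hc
      cases c with
      | zero =>
        obtain rfl : a = p := by omega
        simp
      | succ c =>
        obtain rfl : p = a + c + 1 := by omega
        have hv := iha (c + 2) (by omega)
        have hc0 := qInt_natCast_add_one_ne_zero c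
        have e : ((a + c + 1 : ℕ) : ℤ) - a = c + 1 := by push_cast; ring
        have h1 := congrArg (· * dividedPow x c)
          (h.mul_dividedPow_mul_dividedPow a (a + c + 1))
        have h2 := congrArg (y * ·) (ihp (a + 1) c (by omega))
        have h3 := congrArg (dividedPow y (c + 1) * ·)
          (h.symm.dividedPow_mul_dividedPow_mul a (a + c + 1))
        have h4 := congrArg (· * (dividedPow x (a + c + 1) * dividedPow y (a + 1)))
          (mul_dividedPow y c)
        have h5 := congrArg (· * (dividedPow x (a + c + 1 + 1) * dividedPow y a))
          (dividedPow_mul y (c + 1))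
        simp only [e, add_mul, mul_add, smul_mul_assoc, mul_smul_comm, mul_assoc,
          mul_dividedPow] at h1 h2 h3 h5
        simp only [smul_mul_assoc, mul_assoc] at h4
        -- the identity of level `p`, multiplied by `y` from the left and divided by `[c + 1]`
        have h6 : dividedPow y (c + 1) * (dividedPow x (a + c + 1) * dividedPow y (a + 1)) =
            dividedPow x (a + 1) * (dividedPow y (a + c + 1 + 1) * dividedPow x c) +
              dividedPow x a * (dividedPow y (a + c + 1 + 1) * dividedPow x (c + 1)) := by
          refine smul_right_injective A hc0 ?_
          linear_combination (norm := module) -h4 + h1 - h2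
        have h7 := congrArg (· * x) h6
        simp only [add_mul, mul_assoc, dividedPow_mul, mul_smul_comm] at h7
        refine smul_right_injective A hc0 ?_
        simp only [mul_assoc] at hv ⊢
        linear_combination (norm := module) h3 + h5 - h7 - qInt ((c + 1 : ℕ) + 1) • hv

end IsSerrePair

/-! ### The quantum binomial formula and its inverse -/

section QuantumBinomial

variable {A : Type*} [Ring A] [Algebra 𝔽 A] {x y : A}

theorem dividedPow_mul_of_qCommute (h : y * x = q ^ (2 : ℤ) • (x * y)) (k : ℕ) :
    dividedPow y k * x = q ^ (2 * k : ℤ) • (x * dividedPow y k) := by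
  have hp : y ^ k * x = q ^ (2 * k : ℤ) • (x * y ^ k) := by
    induction k with
    | zero => simp
    | succ k ih =>
      rw [pow_succ, mul_assoc, h, mul_smul_comm, ← mul_assoc, ih, smul_mul_assoc, smul_smul,
        mul_assoc, ← zpow_add₀ q_ne_zero]
      congr 2
      push_cast
      ring
  rw [dividedPow, smul_mul_assoc, hp, mul_smul_comm, smul_comm]

/-- The coefficient comparison behind a Pascal recursion. -/
theorem sum_range_pascal (u : ℕ → A) {α β γ : ℕ → 𝔽} {b : ℕ} (h0 : γ 0 = α 0)
    (hs : ∀ j ≤ b, γ (j + 1) = α (j + 1) + β j) (hα : α (b + 1) = 0) :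
    ∑ j ∈ Finset.range (b + 1), (α j • u j + β j • u (j + 1)) =
      ∑ j ∈ Finset.range (b + 1 + 1), γ j • u j := by
  have h1 : ∑ j ∈ Finset.range (b + 1), γ (j + 1) • u (j + 1) =
      ∑ j ∈ Finset.range (b + 1), (α (j + 1) • u (j + 1) + β j • u (j + 1)) :=
    Finset.sum_congr rfl fun j hj => by
      rw [hs j (Nat.lt_succ_iff.mp (Finset.mem_range.mp hj)), add_smul]
  have h2 := (Finset.sum_range_succ' (fun j => α j • u j) (b + 1)).symm.trans
    (Finset.sum_range_succ (fun j => α j • u j) (b + 1))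
  rw [hα, zero_smul, add_zero] at h2
  rw [Finset.sum_range_succ' _ (b + 1), h1, Finset.sum_add_distrib, Finset.sum_add_distrib, ← h2,
    h0]
  abel

/-- The quantum binomial formula, by induction on `b` with multiplication by `x + y` from the
right. -/
theorem dividedPow_add (h : y * x = q ^ (2 : ℤ) • (x * y)) (b : ℕ) :
    dividedPow (x + y) b = ∑ j ∈ Finset.range (b + 1),
      q ^ ((j : ℤ) * (b - j)) • (dividedPow x (b - j) * dividedPow y j) := by
  have hq := q_ne_zero
  induction b with
  | zero => simp
  | succ b ih =>
    refine smul_right_injective A (qInt_natCast_add_one_ne_zero b) ?_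
    beta_reduce
    rw [← dividedPow_mul, ih, Finset.sum_mul, Finset.smul_sum]
    simp only [smul_smul]
    rw [← sum_range_pascal (fun j => dividedPow x (b + 1 - j) * dividedPow y j)
      (α := fun j => q ^ ((j : ℤ) * (b - j) + 2 * j) * qInt ((b : ℤ) - j + 1))
      (β := fun j => q ^ ((j : ℤ) * (b - j)) * qInt (j + 1))]
    · refine Finset.sum_congr rfl fun j hj => ?_
      have hj' : j ≤ b := by simpa [Nat.lt_succ_iff] using hj
      obtain ⟨d, rfl⟩ := Nat.exists_eq_add_of_le hj'
      rw [mul_add, smul_mul_assoc, smul_mul_assoc, mul_assoc, dividedPow_mul_of_qCommute h,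
        mul_assoc, dividedPow_mul, mul_smul_comm, mul_smul_comm, ← mul_assoc (dividedPow x _),
        show j + d - j = d by omega, dividedPow_mul, show j + d + 1 - j = d + 1 by omega,
        show j + d + 1 - (j + 1) = d by omega, smul_mul_assoc]
      simp only [smul_smul, Nat.cast_add, add_sub_cancel_left, zpow_add₀ hq, mul_assoc]
    · simp
    · intro j hj
      have := qInt_add ((b : ℤ) - j) (j + 1)
      rw [show (b : ℤ) - j + (j + 1) = b + 1 by ring] at this
      push_cast
      rw [this,
        show ((j : ℤ) + 1) * (b - (j + 1)) + 2 * (j + 1) = (j + 1) * (b - j) + (j + 1) by ring,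
        show (j : ℤ) * (b - j) = (j + 1) * (b - j) + -(b - j) by ring,
        show (b : ℤ) - (j + 1) + 1 = b - j by ring,
        show ((j : ℤ) + 1) * (b + 1 - (j + 1)) = (j + 1) * (b - j) by ring,
        zpow_add₀ hq _ (_ + 1), zpow_add₀ hq _ (-_)]
      ring
    · simp

/-- The inverse of the quantum binomial formula, by induction on `b` with multiplication by `x` from
the right. -/
theorem dividedPow_eq_sum_dividedPow_add (h : y * x = q ^ (2 : ℤ) • (x * y)) (b : ℕ) :
    dividedPow x b = ∑ j ∈ Finset.range (b + 1),
      ((-1) ^ j * q ^ ((j : ℤ) * (b - 1))) • (dividedPow (x + y) (b - j) * dividedPow y j) := by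
  have hq := q_ne_zero
  induction b with
  | zero => simp
  | succ b ih =>
    refine smul_right_injective A (qInt_natCast_add_one_ne_zero b) ?_
    beta_reduce
    rw [← dividedPow_mul, ih, Finset.sum_mul, Finset.smul_sum]
    simp only [smul_smul]
    rw [← sum_range_pascal (fun j => dividedPow (x + y) (b + 1 - j) * dividedPow y j)
      (α := fun j => (-1) ^ j * q ^ ((j : ℤ) * (b - 1) + 2 * j) * qInt ((b : ℤ) - j + 1))
      (β := fun j => -((-1) ^ j * q ^ ((j : ℤ) * (b - 1) + 2 * j) * qInt (j + 1)))]
    · refine Finset.sum_congr rfl fun j hj => ?_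
      have hj' : j ≤ b := by simpa [Nat.lt_succ_iff] using hj
      obtain ⟨d, rfl⟩ := Nat.exists_eq_add_of_le hj'
      have hx : dividedPow (x + y) d * x * dividedPow y j =
          qInt (d + 1) • (dividedPow (x + y) (d + 1) * dividedPow y j) -
            qInt (j + 1) • (dividedPow (x + y) d * dividedPow y (j + 1)) := by
        rw [← smul_mul_assoc, ← mul_smul_comm, ← dividedPow_mul (x + y), ← mul_dividedPow y,
          ← mul_assoc, ← sub_mul, ← mul_sub, add_sub_cancel_right]
      rw [smul_mul_assoc, mul_assoc, dividedPow_mul_of_qCommute h, mul_smul_comm, ← mul_assoc,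
        show j + d - j = d by omega, show j + d + 1 - j = d + 1 by omega,
        show j + d + 1 - (j + 1) = d by omega, hx, zpow_add₀ hq, Nat.cast_add,
        add_sub_cancel_left]
      module
    · simp
    · intro j hj
      have := qInt_add ((b : ℤ) - j) (j + 1)
      rw [show (b : ℤ) - j + (j + 1) = b + 1 by ring] at this
      push_cast
      rw [this, pow_succ, show (b : ℤ) - (j + 1) + 1 = b - j by ring,
        show ((j : ℤ) + 1) * (b - 1) + 2 * (j + 1) = (j + 1) * b + (j + 1) by ring,
        show (j : ℤ) * (b - 1) + 2 * j = (j + 1) * b + -(b - j) by ring,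
        show ((j : ℤ) + 1) * (b + 1 - 1) = (j + 1) * b by ring, zpow_add₀ hq _ (_ + 1),
        zpow_add₀ hq _ (-_)]
      ring
    · simp

end QuantumBinomial

/-! ### Relations of `U(sl₃)` and weight vectors -/

theorem tau_ne (i : Fin 2) : tau i ≠ i := by
  fin_cases i <;> simp [tau]

@[simp] theorem tau_tau (i : Fin 2) : tau (tau i) = i := by
  fin_cases i <;> simp [tau]

theorem eq_or_eq_tau (i j : Fin 2) : j = i ∨ j = tau i := by
  fin_cases i <;> fin_cases j <;> simp [tau]

@[simp] theorem cartan_self (i : Fin 2) : cartan i i = 2 := by simp [cartan]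

theorem cartan_ne {i j : Fin 2} (h : i ≠ j) : cartan i j = -1 := by simp [cartan, h]

theorem K_mul_Kinv (i : Fin 2) : K i * Kinv i = 1 := by
  simpa [K, Kinv, U.of] using RingQuot.mkAlgHom_rel 𝔽 (Rel.K_mul_Kinv i)

theorem Kinv_mul_K (i : Fin 2) : Kinv i * K i = 1 := by
  simpa [K, Kinv, U.of] using RingQuot.mkAlgHom_rel 𝔽 (Rel.Kinv_mul_K i)

theorem K_mul_F (i j : Fin 2) : K i * F j = q ^ (-cartan i j) • (F j * K i) := by
  simpa only [K, F, U.of, map_mul, map_smul] using RingQuot.mkAlgHom_rel 𝔽 (Rel.K_F i j)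

theorem E_mul_F_self (i : Fin 2) :
    E i * F i = F i * E i + (q - q⁻¹)⁻¹ • (K i - Kinv i) := by
  rw [← sub_eq_iff_eq_add']
  simpa only [K, Kinv, E, F, U.of, map_mul, map_smul, map_sub] using
    RingQuot.mkAlgHom_rel 𝔽 (Rel.E_F_same i)

theorem E_mul_F_of_ne {i j : Fin 2} (h : i ≠ j) : E i * F j = F j * E i := by
  rw [← sub_eq_zero]
  simpa only [E, F, U.of, map_mul, map_sub, map_zero] using
    RingQuot.mkAlgHom_rel 𝔽 (Rel.E_F_ne i j h)

theorem isSerrePair_F {i j : Fin 2} (h : i ≠ j) : IsSerrePair (F i) (F j) := by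
  have key : ∀ {i j : Fin 2}, i ≠ j →
      dividedPow (F i) 2 * F j - F i * F j * F i + F j * dividedPow (F i) 2 = 0 := fun {i j} h => by
    simpa only [F, U.of, map_mul, map_sub, map_add, map_zero, map_dividedPow] using
      RingQuot.mkAlgHom_rel 𝔽 (Rel.serre_F i j h)
  exact ⟨key h, key h.symm⟩

theorem Kinv_mul_of_K_mul {i : Fin 2} {x : U} {z : ℤ} (h : K i * x = q ^ z • (x * K i)) :
    Kinv i * x = q ^ (-z) • (x * Kinv i) := by
  have h1 : x * Kinv i = q ^ z • (Kinv i * x) := by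
    calc x * Kinv i = Kinv i * (K i * x) * Kinv i := by
          rw [← mul_assoc, Kinv_mul_K, one_mul]
      _ = q ^ z • (Kinv i * x) := by
          rw [h, mul_smul_comm, smul_mul_assoc, mul_assoc, mul_assoc x, K_mul_Kinv, mul_one]
  rw [h1, smul_smul, ← zpow_add₀ q_ne_zero, neg_add_cancel, zpow_zero, one_smul]

/-- A subspace of a `U`-module that is stable under the generators is stable under `U`. -/
theorem smul_mem_of_generators {V : Type*} [AddCommGroup V] [Module 𝔽 V] [Module U V]
    [IsScalarTower 𝔽 U V] (N : Submodule 𝔽 V) (hE : ∀ i, ∀ v ∈ N, E i • v ∈ N)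
    (hF : ∀ i, ∀ v ∈ N, F i • v ∈ N) (hK : ∀ i, ∀ v ∈ N, K i • v ∈ N)
    (hKinv : ∀ i, ∀ v ∈ N, Kinv i • v ∈ N) (u : U) : ∀ v ∈ N, u • v ∈ N := by
  obtain ⟨x, rfl⟩ := RingQuot.mkAlgHom_surjective 𝔽 Rel u
  induction x using FreeAlgebra.induction with
  | grade0 r =>
    intro v hv
    rw [AlgHom.commutes, algebraMap_smul]
    exact N.smul_mem r hv
  | grade1 x =>
    cases x with
    | E i => exact hE i
    | F i => exact hF i
    | K i => exact hK i
    | Kinv i => exact hKinv i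
  | mul a b ha hb =>
    intro v hv
    rw [map_mul, mul_smul]
    exact ha _ (hb v hv)
  | add a b ha hb =>
    intro v hv
    rw [map_add, add_smul]
    exact N.add_mem (ha v hv) (hb v hv)

section Weights

variable {V : Type*} [AddCommGroup V] [Module U V]

theorem E_smul_F_smul_of_ne {i j : Fin 2} (h : i ≠ j) (v : V) :
    E i • F j • v = F j • E i • v := by
  rw [← mul_smul, E_mul_F_of_ne h, mul_smul]

theorem E_smul_dividedPow_F_smul_of_ne {i j : Fin 2} (h : i ≠ j) (k : ℕ) (v : V) :
    E i • dividedPow (F j) k • v = dividedPow (F j) k • E i • v := by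
  have : Commute (E i) (F j) := E_mul_F_of_ne h
  rw [← mul_smul, ← mul_smul, dividedPow, mul_smul_comm, (this.pow_right k).eq, smul_mul_assoc]

variable [Module 𝔽 V]

/-- `v` is a (possibly zero) vector of weight `x 0 ω₁ + x 1 ω₂`. -/
def IsWeightVector (x : Fin 2 → ℤ) (v : V) : Prop := ∀ i, K i • v = q ^ x i • v

variable [IsScalarTower 𝔽 U V] {x : Fin 2 → ℤ} {v : V}

theorem IsWeightVector.Kinv_smul (h : IsWeightVector x v) (i : Fin 2) :
    Kinv i • v = q ^ (-x i) • v := by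
  have h1 : v = q ^ x i • (Kinv i • v) := by
    rw [← smul_comm, ← h i, ← mul_smul, Kinv_mul_K, one_smul]
  conv_rhs => rw [h1]
  rw [smul_smul, ← zpow_add₀ q_ne_zero, neg_add_cancel, zpow_zero, one_smul]

theorem IsWeightVector.F_smul (h : IsWeightVector x v) (j : Fin 2) :
    IsWeightVector (fun i => x i - cartan i j) (F j • v) := by
  intro i
  rw [← mul_smul, K_mul_F, smul_assoc, mul_smul, h i, smul_comm (F j), smul_smul,
    ← zpow_add₀ q_ne_zero, neg_add_eq_sub]

theorem IsWeightVector.dividedPow_F_smul (h : IsWeightVector x v) (j : Fin 2) (k : ℕ) :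
    IsWeightVector (fun i => x i - k * cartan i j) (dividedPow (F j) k • v) := by
  induction k with
  | zero => simpa using h
  | succ k ih =>
    intro i
    rw [dividedPow_succ, smul_assoc, mul_smul, smul_comm (K i), ih.F_smul j i,
      smul_comm (qInt ((k : ℤ) + 1))⁻¹ (q ^ _)]
    congr 2
    push_cast
    ring

theorem E_smul_F_smul (h : IsWeightVector x v) (i : Fin 2) :
    E i • F i • v = F i • E i • v + qInt (x i) • v := by
  rw [← mul_smul, E_mul_F_self, add_smul, mul_smul, smul_assoc, sub_smul, h i, h.Kinv_smul i,
    ← sub_smul, smul_smul (q - q⁻¹)⁻¹, qInt, div_eq_inv_mul]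

theorem E_smul_dividedPow_succ_F_smul (h : IsWeightVector x v) (i : Fin 2) (k : ℕ) :
    E i • dividedPow (F i) (k + 1) • v =
      dividedPow (F i) (k + 1) • E i • v + qInt (x i - k) • dividedPow (F i) k • v := by
  induction k with
  | zero => simpa using E_smul_F_smul h i
  | succ k ih =>
    have hs := qInt_mul_sub_mul ((k : ℤ) + 2) (x i - k - 1)
    have hk := qInt_natCast_add_one_ne_zero (k + 1)
    have h1 := congrArg (· • v) (mul_dividedPow (F i) k)
    have h2 := congrArg (· • (E i • v)) (mul_dividedPow (F i) (k + 1))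
    have h3 := congrArg (E i • · • v) (mul_dividedPow (F i) (k + 1))
    simp only [mul_smul, smul_assoc] at h1 h2 h3
    rw [E_smul_F_smul (h.dividedPow_F_smul i (k + 1)), ih, smul_add, smul_comm (F i) (qInt _),
      h1, h2, smul_comm (E i)] at h3
    refine smul_right_injective V hk ?_
    beta_reduce
    rw [← h3]
    simp only [cartan_self]
    push_cast at *
    rw [show (k : ℤ) + 2 - 1 = k + 1 by ring, show x i - (k : ℤ) - 1 + 1 = x i - k by ring,
      show x i - (k : ℤ) - 1 - (k + 2) + 1 = x i - (k + 1) * 2 by ring,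
      show (k : ℤ) + 2 = k + 1 + 1 by ring, show x i - (k : ℤ) - 1 = x i - (k + 1) by ring] at hs
    generalize dividedPow (F i) (k + 1) • v = w
    generalize dividedPow (F i) (k + 1 + 1) • E i • v = w'
    linear_combination (norm := module) -hs • w

end Weights

/-! ### Simple highest weight modules -/

section Simple

variable {V : Type*} [AddCommGroup V] [Module U V]

/-- The vectors obtained from `u` by repeatedly applying the generators `F i`. -/
inductive IsDescendant (u : V) : V → Prop
  | base : IsDescendant u u
  | step (i : Fin 2) (v : V) : IsDescendant u v → IsDescendant u (F i • v)

variable [Module 𝔽 V]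

theorem IsHighestWeightVector.isWeightVector {m n : ℕ} {η : V}
    (hη : IsHighestWeightVector m n η) :
    IsWeightVector (fun i => (wt m n i : ℤ)) η := fun i => by
  rw [hη.K_smul, zpow_natCast]

variable [IsScalarTower 𝔽 U V]

theorem smul_mem_span {S : Set V} {a : U} (h : ∀ v ∈ S, a • v ∈ Submodule.span 𝔽 S) :
    ∀ v ∈ Submodule.span 𝔽 S, a • v ∈ Submodule.span 𝔽 S := by
  intro v hv
  induction hv using Submodule.span_induction with
  | mem v hv => exact h v hv
  | zero => rw [smul_zero]; exact Submodule.zero_mem _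
  | add v w _ _ hv hw => rw [smul_add]; exact Submodule.add_mem _ hv hw
  | smul r v _ hv => rw [smul_comm]; exact Submodule.smul_mem _ r hv

/-- A simple module is generated from any nonzero primitive vector by the `F i` alone. -/
theorem eq_top_of_primitive [IsSimpleModule U V] {u : V} {x : Fin 2 → ℤ} (hu : u ≠ 0)
    (hx : IsWeightVector x u) (hE : ∀ i, E i • u = 0) (N : Submodule 𝔽 V) (huN : u ∈ N)
    (hN : ∀ i, ∀ v ∈ N, F i • v ∈ N) : N = ⊤ := by
  -- the span of the descendants is stable under `U`, hence is everything
  set D : Submodule 𝔽 V := Submodule.span 𝔽 {v | IsDescendant u v} with hD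
  have hwt : ∀ v, IsDescendant u v → ∃ y : Fin 2 → ℤ, IsWeightVector y v := by
    intro v hv
    induction hv with
    | base => exact ⟨x, hx⟩
    | step i v _ ih =>
      obtain ⟨y, hy⟩ := ih
      exact ⟨_, hy.F_smul i⟩
  have hDF : ∀ i, ∀ v ∈ D, F i • v ∈ D := fun i =>
    smul_mem_span fun v hv => Submodule.subset_span (IsDescendant.step i v hv)
  have hDK : ∀ i, ∀ v ∈ D, K i • v ∈ D := fun i => smul_mem_span fun v hv => by
    obtain ⟨y, hy⟩ := hwt v hv
    rw [hy i]
    exact Submodule.smul_mem _ _ (Submodule.subset_span hv)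
  have hDKinv : ∀ i, ∀ v ∈ D, Kinv i • v ∈ D := fun i => smul_mem_span fun v hv => by
    obtain ⟨y, hy⟩ := hwt v hv
    rw [hy.Kinv_smul i]
    exact Submodule.smul_mem _ _ (Submodule.subset_span hv)
  have hDE : ∀ i, ∀ v ∈ D, E i • v ∈ D := fun i => smul_mem_span fun v hv => by
    induction hv with
    | base => rw [hE]; exact Submodule.zero_mem _
    | step j v hv ih =>
      obtain ⟨y, hy⟩ := hwt v hv
      by_cases hij : i = j
      · subst hij
        rw [E_smul_F_smul hy]
        exact Submodule.add_mem _ (hDF _ _ ih)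
          (Submodule.smul_mem _ _ (Submodule.subset_span hv))
      · rw [E_smul_F_smul_of_ne hij]
        exact hDF _ _ ih
  let D' : Submodule U V :=
    { carrier := D
      add_mem' := D.add_mem
      zero_mem' := D.zero_mem
      smul_mem' := fun a v hv => smul_mem_of_generators D hDE hDF hDK hDKinv a v hv }
  have huD : u ∈ D' := Submodule.subset_span IsDescendant.base
  have hD' : D' = ⊤ := by
    refine (eq_bot_or_eq_top D').resolve_left fun h => hu ?_
    rwa [h, Submodule.mem_bot] at huD
  have hDN : D ≤ N := by
    refine Submodule.span_le.mpr fun v hv => ?_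
    induction hv with
    | base => exact huN
    | step i v _ ih => exact hN i v ih
  refine eq_top_iff.mpr fun v _ => hDN ?_
  have : v ∈ D' := hD' ▸ Submodule.mem_top
  exact this

theorem K_mul_K_mul_F (j : Fin 2) : K 0 * K 1 * F j = q ^ (-1 : ℤ) • (F j * (K 0 * K 1)) := by
  rw [mul_assoc, K_mul_F, mul_smul_comm, ← mul_assoc, K_mul_F, smul_mul_assoc, smul_smul,
    ← zpow_add₀ q_ne_zero, mul_assoc]
  congr 2
  fin_cases j <;> simp [cartan]

variable {m n : ℕ} {η : V}

variable [IsSimpleModule U V]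

/-- In a simple highest weight module there is no nonzero primitive vector of lower weight. -/
theorem IsHighestWeightVector.eq_zero_of_primitive (hη : IsHighestWeightVector m n η) {u : V}
    {x : Fin 2 → ℤ} (hx : IsWeightVector x u) (hE : ∀ i, E i • u = 0)
    (hlt : x 0 + x 1 < m + n) : u = 0 := by
  by_contra hu
  let T : Module.End 𝔽 V := Algebra.lsmul 𝔽 𝔽 V (K 0 * K 1)
  have hT : ∀ {y : Fin 2 → ℤ} {v : V}, IsWeightVector y v → T v = q ^ (y 0 + y 1) • v := by
    intro y v hv
    change (K 0 * K 1) • v = _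
    rw [mul_smul, hv 1, smul_comm, hv 0, smul_smul, ← zpow_add₀ q_ne_zero, add_comm]
  -- the span of the weight spaces whose weight is lower than that of `η`
  let N : Submodule 𝔽 V := ⨆ d : ℕ, T.eigenspace (q ^ ((m + n : ℤ) - 1 - d))
  have huN : u ∈ N := by
    refine Submodule.mem_iSup_of_mem (m + n - 1 - (x 0 + x 1)).toNat ?_
    rw [Module.End.mem_eigenspace_iff, hT hx, Int.toNat_of_nonneg (by omega)]
    congr 2
    ring
  have hN : ∀ i, ∀ v ∈ N, F i • v ∈ N := by
    intro i v hv
    induction hv using Submodule.iSup_induction' with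
    | mem d v hv =>
      refine Submodule.mem_iSup_of_mem (d + 1) ?_
      rw [Module.End.mem_eigenspace_iff] at hv ⊢
      change (K 0 * K 1) • v = _ at hv
      change (K 0 * K 1) • F i • v = _
      rw [← mul_smul, K_mul_K_mul_F, smul_assoc, mul_smul, hv, smul_comm (F i), smul_smul,
        ← zpow_add₀ q_ne_zero]
      congr 2
      push_cast
      ring
    | zero => rw [smul_zero]; exact Submodule.zero_mem _
    | add v w _ _ hv hw => rw [smul_add]; exact Submodule.add_mem _ hv hw
  have htop := eq_top_of_primitive hu hx hE N huN hN
  have hη' : η ∈ T.eigenspace (q ^ (m + n : ℤ)) := by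
    rw [Module.End.mem_eigenspace_iff, hT hη.isWeightVector]
    simp [wt]
  have hdisj := T.eigenspaces_iSupIndep (q ^ (m + n : ℤ))
  refine hη.ne_zero (Submodule.disjoint_def.mp hdisj η hη' ?_)
  have hle : N ≤ ⨆ μ, ⨆ (_ : μ ≠ q ^ (m + n : ℤ)), T.eigenspace μ :=
    iSup_le fun d => le_iSup₂_of_le _ (fun h => by
      have := q_zpow_injective h
      omega) le_rfl
  exact hle (htop ▸ Submodule.mem_top)

end Simple

section Monomials

variable {V : Type*} [AddCommGroup V] [Module 𝔽 V] [Module U V] {m n : ℕ} {η : V}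

theorem IsHighestWeightVector.E_tau_smul_dividedPow (hη : IsHighestWeightVector m n η)
    (i : Fin 2) (c : ℕ) : E (tau i) • dividedPow (F i) c • η = 0 := by
  rw [E_smul_dividedPow_F_smul_of_ne (tau_ne i), hη.E_smul, smul_zero]

theorem IsHighestWeightVector.E_smul_dividedPow_zero (hη : IsHighestWeightVector m n η)
    (i : Fin 2) (b : ℕ) :
    E i • dividedPow (F (tau i)) b • dividedPow (F i) 0 • η = 0 := by
  rw [E_smul_dividedPow_F_smul_of_ne (tau_ne i).symm, dividedPow_zero, one_smul, hη.E_smul,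
    smul_zero]

variable [IsScalarTower 𝔽 U V]

theorem IsHighestWeightVector.isWeightVector_dividedPow (hη : IsHighestWeightVector m n η)
    (i : Fin 2) (b c : ℕ) :
    IsWeightVector (fun j => (wt m n j : ℤ) - c * cartan j i - b * cartan j (tau i))
      (dividedPow (F (tau i)) b • dividedPow (F i) c • η) :=
  (hη.isWeightVector.dividedPow_F_smul i c).dividedPow_F_smul (tau i) b

theorem IsHighestWeightVector.E_tau_smul_dividedPow_succ (hη : IsHighestWeightVector m n η)
    (i : Fin 2) (b c : ℕ) :
    E (tau i) • dividedPow (F (tau i)) (b + 1) • dividedPow (F i) c • η =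
      qInt ((wt m n (tau i) : ℤ) + c - b) •
        dividedPow (F (tau i)) b • dividedPow (F i) c • η := by
  rw [E_smul_dividedPow_succ_F_smul (hη.isWeightVector.dividedPow_F_smul i c),
    hη.E_tau_smul_dividedPow, smul_zero, zero_add, cartan_ne (tau_ne i)]
  simp

theorem IsHighestWeightVector.E_smul_dividedPow_succ (hη : IsHighestWeightVector m n η)
    (i : Fin 2) (b c : ℕ) :
    E i • dividedPow (F (tau i)) b • dividedPow (F i) (c + 1) • η =
      qInt ((wt m n i : ℤ) - c) • dividedPow (F (tau i)) b • dividedPow (F i) c • η := by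
  rw [E_smul_dividedPow_F_smul_of_ne (tau_ne i).symm,
    E_smul_dividedPow_succ_F_smul hη.isWeightVector, hη.E_smul, smul_zero, zero_add,
    smul_comm (dividedPow _ b)]

variable [IsSimpleModule U V]

/-- `F_i^(c) η` is killed by `E_{τ i}` and has weight `λ_{τ i} + c` at `τ i`. -/
theorem IsHighestWeightVector.dividedPow_dividedPow_eq_zero (hη : IsHighestWeightVector m n η)
    (i : Fin 2) (c b : ℕ) (hb : wt m n (tau i) + c < b) :
    dividedPow (F (tau i)) b • dividedPow (F i) c • η = 0 := by
  -- only `b = n + c + 1` needs an argument: there the vector is primitive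
  suffices h : dividedPow (F (tau i)) (wt m n (tau i) + c + 1) • dividedPow (F i) c • η = 0 by
    induction b, hb using Nat.le_induction with
    | base => exact h
    | succ b _ ih => rw [dividedPow_succ, smul_assoc, mul_smul, ih, smul_zero, smul_zero]
  have hself (c : ℕ) : E (tau i) • dividedPow (F (tau i)) (wt m n (tau i) + c + 1) •
      dividedPow (F i) c • η = 0 := by
    rw [hη.E_tau_smul_dividedPow_succ, Nat.cast_add, sub_self, qInt_zero, zero_smul]
  have hprim (c : ℕ) (h : E i • dividedPow (F (tau i)) (wt m n (tau i) + c + 1) •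
      dividedPow (F i) c • η = 0) :
      dividedPow (F (tau i)) (wt m n (tau i) + c + 1) • dividedPow (F i) c • η = 0 := by
    refine hη.eq_zero_of_primitive (hη.isWeightVector_dividedPow i _ c) (fun j => ?_) ?_
    · obtain rfl | rfl := eq_or_eq_tau i j
      · exact h
      · exact hself c
    · fin_cases i <;> simp [wt, tau, cartan] <;> omega
  clear hb b
  induction c with
  | zero => exact hprim 0 (hη.E_smul_dividedPow_zero i _)
  | succ c ih =>
    refine hprim (c + 1) ?_
    rw [hη.E_smul_dividedPow_succ, show wt m n (tau i) + (c + 1) + 1 =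
      wt m n (tau i) + c + 1 + 1 by ring, dividedPow_succ, smul_assoc, mul_smul, ih,
      smul_zero, smul_zero, smul_zero]

theorem IsHighestWeightVector.dividedPow_eq_zero (hη : IsHighestWeightVector m n η)
    (i : Fin 2) (c : ℕ) (hc : wt m n i < c) : dividedPow (F i) c • η = 0 := by
  simpa using hη.dividedPow_dividedPow_eq_zero (tau i) 0 c (by simpa using hc)

end Monomials

/-! ### The canonical basis -/

theorem triple_smul {A V : Type*} [Ring A] [Algebra 𝔽 A] [AddCommGroup V] [Module A V]
    (X : Fin 2 → A) (i : Fin 2) (a b c : ℕ) (v : V) :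
    triple X i a b c • v =
      dividedPow (X i) a • dividedPow (X (tau i)) b • dividedPow (X i) c • v := by
  rw [triple, mul_smul, mul_smul]

theorem triple_F_eq (i : Fin 2) (a c : ℕ) :
    triple F i a (a + c) c = triple F (tau i) c (a + c) a := by
  rw [triple, triple, tau_tau]
  exact (isSerrePair_F (tau_ne i).symm).dividedPow_triple_eq (a + c) a c rfl

section Spanning

variable {V : Type*} [AddCommGroup V] [Module 𝔽 V] [Module U V] [IsScalarTower 𝔽 U V]
variable {m n : ℕ} {η : V}

theorem IsHighestWeightVector.triple_F_smul_eq_zero [IsSimpleModule U V]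
    (hη : IsHighestWeightVector m n η) (i : Fin 2) {a b c : ℕ}
    (h : c ≤ wt m n i → c + wt m n (tau i) < b) : triple F i a b c • η = 0 := by
  rw [triple_smul]
  by_cases hc : c ≤ wt m n i
  · rw [hη.dividedPow_dividedPow_eq_zero i c b (by have := h hc; omega), smul_zero]
  · rw [hη.dividedPow_eq_zero i c (by omega), smul_zero, smul_zero]

/-- The nonzero vectors among the `x η`, with `x` in the canonical basis of `U⁻`, are indexed by
`CBIndex`; for `i = 1` and `b = a + c` the index lies in the other family. -/
theorem IsHighestWeightVector.triple_F_smul_eq_zero_or_exists [IsSimpleModule U V]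
    (hη : IsHighestWeightVector m n η) (i : Fin 2) (a b c : ℕ) (h : a + c ≤ b) :
    triple F i a b c • η = 0 ∨
      ∃ x : CBIndex m n, triple F i a b c = triple F x.i x.a x.b x.c := by
  by_cases hidx : c ≤ wt m n i → c + wt m n (tau i) < b
  · exact Or.inl (hη.triple_F_smul_eq_zero i hidx)
  right
  obtain ⟨hc, hb⟩ := Classical.not_imp.mp hidx
  by_cases hi : i = 1 → a + c < b
  · exact ⟨⟨i, a, b, c, hc, h, by omega, hi⟩, rfl⟩
  · obtain ⟨rfl, hab⟩ := Classical.not_imp.mp hi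
    obtain rfl : b = a + c := by omega
    have ht : tau 1 = 0 := rfl
    rw [ht] at hb
    refine ⟨⟨0, c, a + c, a, by omega, by omega, ?_, by simp⟩, triple_F_eq 1 a c⟩
    have ht : tau 0 = 1 := rfl
    rw [ht]
    omega

theorem F_tau_mul_triple (i : Fin 2) (a b c : ℕ) (h : a + c ≤ b) :
    F (tau i) * triple F i a b c ∈
      Submodule.span 𝔽 {x | ∃ i a b c, a + c ≤ b ∧ x = triple F i a b c} := by
  cases a with
  | zero =>
    rw [triple, dividedPow_zero, one_mul, ← mul_assoc, mul_dividedPow, smul_mul_assoc]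
    refine Submodule.smul_mem _ _ (Submodule.subset_span ⟨i, 0, b + 1, c, by omega, ?_⟩)
    rw [triple, dividedPow_zero, one_mul]
  | succ a =>
    rw [triple, ← mul_assoc, ← mul_assoc,
      (isSerrePair_F (tau_ne i).symm).mul_dividedPow_mul_dividedPow, add_mul, smul_mul_assoc,
      mul_assoc _ (F i), mul_dividedPow, mul_smul_comm]
    exact Submodule.add_mem _
      (Submodule.smul_mem _ _ (Submodule.subset_span ⟨i, a + 1, b + 1, c, by omega, rfl⟩))
      (Submodule.smul_mem _ _ (Submodule.subset_span ⟨i, a, b + 1, c + 1, by omega, rfl⟩))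

/-- The span of the canonical basis of `U⁻` is stable under left multiplication by `F_1` and
`F_2`. -/
theorem F_mul_triple (j i : Fin 2) (a b c : ℕ) (h : a + c ≤ b) :
    F j * triple F i a b c ∈
      Submodule.span 𝔽 {x | ∃ i a b c, a + c ≤ b ∧ x = triple F i a b c} := by
  obtain rfl | rfl := eq_or_eq_tau i j
  · by_cases hb : b = a + c
    · subst hb
      have := F_tau_mul_triple (tau j) c (a + c) a (by omega)
      rwa [tau_tau, ← triple_F_eq] at this
    · rw [triple, ← mul_assoc, ← mul_assoc, mul_dividedPow, smul_mul_assoc, smul_mul_assoc]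
      exact Submodule.smul_mem _ _ (Submodule.subset_span ⟨j, a + 1, b, c, by omega, rfl⟩)
  · exact F_tau_mul_triple i a b c h

theorem IsHighestWeightVector.span_eq_top [IsSimpleModule U V]
    (hη : IsHighestWeightVector m n η) :
    Submodule.span 𝔽 (Set.range fun x : CBIndex m n => triple F x.i x.a x.b x.c • η) = ⊤ := by
  set N := Submodule.span 𝔽 (Set.range fun x : CBIndex m n => triple F x.i x.a x.b x.c • η)
  have hmem (i : Fin 2) (a b c : ℕ) (h : a + c ≤ b) : triple F i a b c • η ∈ N := by
    obtain h0 | ⟨x, hx⟩ := hη.triple_F_smul_eq_zero_or_exists i a b c h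
    · rw [h0]
      exact N.zero_mem
    · rw [hx]
      exact Submodule.subset_span ⟨x, rfl⟩
  have hmem' : ∀ x ∈ Submodule.span 𝔽 {x | ∃ i a b c, a + c ≤ b ∧ x = triple F i a b c},
      x • η ∈ N := by
    intro x hx
    induction hx using Submodule.span_induction with
    | mem x hx =>
      obtain ⟨i, a, b, c, h, rfl⟩ := hx
      exact hmem i a b c h
    | zero => rw [zero_smul]; exact N.zero_mem
    | add x y _ _ hx hy => rw [add_smul]; exact N.add_mem hx hy
    | smul r x _ hx => rw [smul_assoc]; exact N.smul_mem r hx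
  refine eq_top_of_primitive hη.ne_zero hη.isWeightVector hη.E_smul N ?_ ?_
  · simpa [triple] using hmem 0 0 0 0 le_rfl
  · intro i
    refine smul_mem_span ?_
    rintro _ ⟨x, rfl⟩
    beta_reduce
    rw [← mul_smul]
    exact hmem' _ (F_mul_triple i x.i x.a x.b x.c x.add_le)

end Spanning

section Independence

variable {V : Type*} [AddCommGroup V] [Module 𝔽 V] [Module U V] [IsScalarTower 𝔽 U V]
variable {m n : ℕ} {η : V}

theorem IsHighestWeightVector.E_tau_smul_triple (hη : IsHighestWeightVector m n η)
    (i : Fin 2) (a b c : ℕ) :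
    E (tau i) • triple F i a (b + 1) c • η =
      qInt ((wt m n (tau i) : ℤ) + c - b) • triple F i a b c • η := by
  rw [triple_smul, triple_smul, E_smul_dividedPow_F_smul_of_ne (tau_ne i),
    hη.E_tau_smul_dividedPow_succ, smul_comm]

theorem IsHighestWeightVector.E_smul_triple_zero_left (hη : IsHighestWeightVector m n η)
    (i : Fin 2) (b c : ℕ) :
    E i • triple F i 0 b (c + 1) • η =
      qInt ((wt m n i : ℤ) - c) • triple F i 0 b c • η := by
  rw [triple_smul, triple_smul, dividedPow_zero, one_smul, one_smul, hη.E_smul_dividedPow_succ]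

theorem IsHighestWeightVector.E_smul_triple_zero_right (hη : IsHighestWeightVector m n η)
    (i : Fin 2) (a b : ℕ) :
    E i • triple F i (a + 1) b 0 • η =
      qInt ((wt m n i : ℤ) + b - a) • triple F i a b 0 • η := by
  rw [triple_smul, triple_smul,
    E_smul_dividedPow_succ_F_smul (hη.isWeightVector_dividedPow i b 0),
    hη.E_smul_dividedPow_zero, smul_zero, zero_add, cartan_ne (tau_ne i).symm]
  simp

theorem IsHighestWeightVector.E_smul_triple (hη : IsHighestWeightVector m n η)
    (i : Fin 2) (a b c : ℕ) :
    E i • triple F i (a + 1) b (c + 1) • η =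
      qInt ((wt m n i : ℤ) - c) • triple F i (a + 1) b c • η +
      qInt ((wt m n i : ℤ) - 2 * (c + 1) + b - a) • triple F i a b (c + 1) • η := by
  rw [triple_smul, triple_smul, triple_smul,
    E_smul_dividedPow_succ_F_smul (hη.isWeightVector_dividedPow i b (c + 1)),
    hη.E_smul_dividedPow_succ, smul_comm (dividedPow _ _), cartan_ne (tau_ne i).symm, cartan_self]
  congr 3
  push_cast
  ring

/-- The action of `E i` on a combination of vectors of weight `λ - (p + 1) (α₁ + α₂)`. -/
theorem IsHighestWeightVector.E_smul_sum (hη : IsHighestWeightVector m n η) (i : Fin 2) (p : ℕ)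
    (l : ℕ → 𝔽) :
    E i • ∑ c ∈ Finset.range (p + 1 + 1), l c • triple F i (p + 1 - c) (p + 1) c • η =
      ∑ c ∈ Finset.range (p + 1),
        (l (c + 1) * qInt ((wt m n i : ℤ) - c) + l c * qInt ((wt m n i : ℤ) - c + 1)) •
          triple F i (p - c) (p + 1) c • η := by
  have hterm : ∀ c ∈ Finset.range (p + 1),
      E i • l (c + 1) • triple F i (p + 1 - (c + 1)) (p + 1) (c + 1) • η =
      (l (c + 1) * qInt ((wt m n i : ℤ) - c)) • triple F i (p - c) (p + 1) c • η +
      if c < p then (l (c + 1) * qInt ((wt m n i : ℤ) - (c + 1 : ℕ) + 1)) •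
        triple F i (p - (c + 1)) (p + 1) (c + 1) • η else 0 := by
    intro c hc
    rw [smul_comm, Nat.add_sub_add_right]
    split_ifs with h
    · obtain ⟨d, rfl⟩ := Nat.exists_eq_add_of_lt h
      rw [show c + d + 1 - c = d + 1 by omega, show c + d + 1 - (c + 1) = d by omega,
        hη.E_smul_triple, smul_add, smul_smul, smul_smul]
      congr 4
      push_cast
      ring
    · obtain rfl : c = p := by rw [Finset.mem_range] at hc; omega
      rw [Nat.sub_self, hη.E_smul_triple_zero_left, add_zero, smul_smul]
  rw [Finset.smul_sum, Finset.sum_range_succ', Finset.sum_congr rfl hterm, Finset.sum_add_distrib,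
    add_assoc]
  simp only [add_smul, Finset.sum_add_distrib]
  congr 1
  rw [Finset.sum_range_succ, if_neg (lt_irrefl p), add_zero, Finset.sum_range_succ']
  congr 1
  · exact Finset.sum_congr rfl fun c hc => by rw [if_pos (Finset.mem_range.mp hc)]
  · rw [Nat.sub_zero, smul_comm, hη.E_smul_triple_zero_right, smul_smul]
    congr 3
    push_cast
    ring

/-- Linear independence inside one weight space. The coefficients of the vectors that vanish are
left arbitrary. -/
theorem IsHighestWeightVector.eq_zero_of_sum_triple (hη : IsHighestWeightVector m n η) (N : ℕ) :
    ∀ (i : Fin 2) (p s : ℕ), p ≤ s → p + s = N → ∀ l : ℕ → 𝔽,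
      ∑ c ∈ Finset.range (p + 1), l c • triple F i (p - c) s c • η = 0 →
      ∀ c ≤ p, c ≤ wt m n i → s ≤ c + wt m n (tau i) → l c = 0 := by
  induction N with
  | zero =>
    intro i p s hps hN l hl c hc _ _
    obtain ⟨rfl, rfl⟩ : p = 0 ∧ s = 0 := by omega
    obtain rfl : c = 0 := by omega
    simpa [triple, hη.ne_zero] using hl
  | succ N ih =>
    intro i p s hps hN l hl
    obtain ⟨s, rfl⟩ : ∃ s', s = s' + 1 := ⟨s - 1, by omega⟩
    obtain hlt | rfl := Nat.lt_or_eq_of_le hps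
    · -- below the diagonal `E (tau i)` is injective on the weight space
      intro c hcp hcm hcs
      have hE := congrArg (E (tau i) • ·) hl
      simp only [Finset.smul_sum, smul_zero, smul_comm (E (tau i)) (l _),
        hη.E_tau_smul_triple, smul_smul] at hE
      have := ih i p s (by omega) (by omega) (fun c => l c * qInt ((wt m n (tau i) : ℤ) + c - s))
        hE c hcp hcm (by omega)
      exact (mul_eq_zero.mp this).resolve_right (qInt_ne_zero (by omega))
    · -- on the diagonal, `E i` relates consecutive coefficients, in both readings of the family
      have key : ∀ (i : Fin 2) (l : ℕ → 𝔽),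
          ∑ c ∈ Finset.range (s + 1 + 1), l c • triple F i (s + 1 - c) (s + 1) c • η = 0 →
          ∀ c ≤ s, c ≤ wt m n i → s + 1 ≤ c + wt m n (tau i) →
          l (c + 1) * qInt ((wt m n i : ℤ) - c) + l c * qInt ((wt m n i : ℤ) - c + 1) = 0 := by
        intro i l hl
        have hE := congrArg (E i • ·) hl
        simp only [hη.E_smul_sum, smul_zero] at hE
        exact ih i s (s + 1) (by omega) (by omega) _ hE
      have h1 := key i l hl
      -- the same vectors, read as members of the family of `tau i`
      have h2 := key (tau i) (fun c => l (s + 1 - c)) (by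
        rw [← hl, ← Finset.sum_range_reflect]
        refine Finset.sum_congr rfl fun c hc => ?_
        have hc' : c ≤ s + 1 := by rw [Finset.mem_range] at hc; omega
        obtain ⟨d, hd⟩ := Nat.exists_eq_add_of_le hc'
        rw [hd, show c + d + 1 - 1 - c = d by omega, show c + d - d = c by omega,
          show c + d - c = d by omega, add_comm c d, triple_F_eq])
      rw [tau_tau] at h2
      have hboth : ∀ c ≤ s, c + 1 ≤ wt m n i → s + 1 ≤ c + wt m n (tau i) →
          l c = 0 ∧ l (c + 1) = 0 := by
        intro c hcs hcm hcn
        have e1 := h1 c hcs (by omega) hcn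
        have e2 := h2 (s - c) (by omega) (by omega) (by omega)
        rw [show s + 1 - (s - c + 1) = c by omega, show s + 1 - (s - c) = c + 1 by omega,
          show (wt m n (tau i) : ℤ) - (s - c : ℕ) = wt m n (tau i) - s + c by omega] at e2
        have hdet := qInt_succ_mul_succ_sub ((wt m n i : ℤ) - c) (wt m n (tau i) - s + c)
        have hne : qInt ((wt m n i : ℤ) - c + (wt m n (tau i) - s + c) + 1) ≠ 0 :=
          qInt_ne_zero (by omega)
        rw [← hdet] at hne
        constructor
        · refine (mul_eq_zero.mp ?_).resolve_right hne
          linear_combination qInt ((wt m n (tau i) : ℤ) - s + c + 1) * e1 -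
            qInt ((wt m n i : ℤ) - c) * e2
        · refine (mul_eq_zero.mp ?_).resolve_right hne
          linear_combination qInt ((wt m n i : ℤ) - c + 1) * e2 -
            qInt ((wt m n (tau i) : ℤ) - s + c) * e1
      intro c hcp hcm hcn
      by_cases hc : c ≤ s
      · by_cases hcm' : c = wt m n i
        · have := h1 c hc hcm hcn
          rwa [← hcm', sub_self, qInt_zero, mul_zero, zero_add, zero_add, qInt_one, mul_one] at this
        · exact (hboth c hc (by omega) hcn).1
      · obtain rfl : c = s + 1 := by omega
        by_cases hn : wt m n (tau i) = 0
        · have := h2 0 (by omega) (by omega) (by omega)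
          simpa [hn] using this
        · exact (hboth s le_rfl (by omega) (by omega)).2


/-- The components of a vanishing sum of eigenvectors vanish. -/
theorem sum_filter_eigenvalue_eq_zero {ι V : Type*} [AddCommGroup V] [Module 𝔽 V]
    (T : Module.End 𝔽 V) (S : Finset ι) (v : ι → V) (e : ι → 𝔽)
    (hv : ∀ x ∈ S, T (v x) = e x • v x) (hsum : ∑ x ∈ S, v x = 0) (r : 𝔽) [DecidableEq 𝔽] :
    ∑ x ∈ S with e x = r, v x = 0 := by
  have hind := T.eigenspaces_iSupIndep r
  have hsplit := Finset.sum_filter_add_sum_filter_not S (fun x => e x = r) v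
  rw [hsum] at hsplit
  refine Submodule.disjoint_def.mp hind _ (Submodule.sum_mem _ fun x hx => ?_) ?_
  · rw [Finset.mem_filter] at hx
    rw [Module.End.mem_eigenspace_iff, hv x hx.1, hx.2]
  · rw [eq_neg_of_add_eq_zero_left hsplit]
    refine Submodule.neg_mem _ (Submodule.sum_mem _ fun x hx => ?_)
    rw [Finset.mem_filter] at hx
    refine Submodule.mem_iSup_of_mem (e x) (Submodule.mem_iSup_of_mem hx.2 ?_)
    rw [Module.End.mem_eigenspace_iff, hv x hx.1]

instance (m n : ℕ) : Finite (CBIndex m n) := by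
  let M := m + n + m + n
  have hb : ∀ x : CBIndex m n, x.a ≤ M ∧ x.b ≤ M ∧ x.c ≤ M := by
    intro x
    have h1 := x.c_le
    have h2 := x.le_add
    have h3 := x.add_le
    have h4 : ∀ i, wt m n i ≤ m + n := fun i => by fin_cases i <;> simp [wt]
    have h5 := h4 x.i
    have h6 := h4 (tau x.i)
    omega
  refine Finite.of_injective (β := Fin 2 × Fin (M + 1) × Fin (M + 1) × Fin (M + 1))
    (fun x => (x.i, ⟨x.a, Nat.lt_succ_iff.mpr (hb x).1⟩, ⟨x.b, Nat.lt_succ_iff.mpr (hb x).2.1⟩,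
      ⟨x.c, Nat.lt_succ_iff.mpr (hb x).2.2⟩)) fun x y h => ?_
  simp only [Prod.mk.injEq, Fin.mk.injEq] at h
  exact CBIndex.ext h.1 h.2.1 h.2.2.1 h.2.2.2

theorem IsHighestWeightVector.isWeightVector_triple (hη : IsHighestWeightVector m n η)
    (i : Fin 2) (a b c : ℕ) :
    IsWeightVector (fun j => (wt m n j : ℤ) - (a + c) * cartan j i - b * cartan j (tau i))
      (triple F i a b c • η) := by
  intro j
  rw [triple_smul, (hη.isWeightVector_dividedPow i b c).dividedPow_F_smul i a j]
  congr 2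
  ring

/-- Indices of equal weight lie in the same family. -/
theorem CBIndex.eq_of_weight_eq (x y : CBIndex m n)
    (h : ∀ j, (x.a + x.c : ℤ) * cartan j x.i + x.b * cartan j (tau x.i) =
      (y.a + y.c) * cartan j y.i + y.b * cartan j (tau y.i)) :
    x.i = y.i ∧ x.a + x.c = y.a + y.c ∧ x.b = y.b := by
  obtain ⟨i, a, b, c, h1, h2, h3, h4⟩ := x
  obtain ⟨i', a', b', c', h1', h2', h3', h4'⟩ := y
  have e0 := h 0
  have e1 := h 1
  dsimp only at *
  fin_cases i <;> fin_cases i' <;> simp [cartan, tau] at e0 e1 h4 h4' ⊢ <;> omega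

theorem IsHighestWeightVector.linearIndependent (hη : IsHighestWeightVector m n η) :
    LinearIndependent 𝔽 (fun x : CBIndex m n => triple F x.i x.a x.b x.c • η) := by
  classical
  have := Fintype.ofFinite (CBIndex m n)
  rw [Fintype.linearIndependent_iff]
  intro g hg x
  let T (j : Fin 2) : Module.End 𝔽 V := Algebra.lsmul 𝔽 𝔽 V (K j)
  let e (j : Fin 2) (y : CBIndex m n) : ℤ :=
    (wt m n j : ℤ) - (y.a + y.c) * cartan j y.i - y.b * cartan j (tau y.i)
  have hT (j : Fin 2) (y : CBIndex m n) : T j (g y • triple F y.i y.a y.b y.c • η) =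
      q ^ e j y • g y • triple F y.i y.a y.b y.c • η := by
    rw [map_smul, smul_comm _ (g y)]
    congr 1
    exact hη.isWeightVector_triple y.i y.a y.b y.c j
  have h0 := sum_filter_eigenvalue_eq_zero (T 0) Finset.univ _ (fun y => q ^ e 0 y)
    (fun y _ => hT 0 y) hg (q ^ e 0 x)
  have h1 := sum_filter_eigenvalue_eq_zero (T 1) _ _ (fun y => q ^ e 1 y)
    (fun y _ => hT 1 y) h0 (q ^ e 1 x)
  rw [Finset.filter_filter] at h1
  -- the sum over one weight space, as a sum over the last exponent `c`
  let l (c : ℕ) : 𝔽 := ∑ y : CBIndex m n with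
    (q ^ e 0 y = q ^ e 0 x ∧ q ^ e 1 y = q ^ e 1 x) ∧ y.c = c, g y
  have hfam (y : CBIndex m n) (hy : q ^ e 0 y = q ^ e 0 x ∧ q ^ e 1 y = q ^ e 1 x) :
      y.i = x.i ∧ y.a + y.c = x.a + x.c ∧ y.b = x.b := by
    have e0 := q_zpow_injective hy.1
    have e1 := q_zpow_injective hy.2
    refine y.eq_of_weight_eq x fun j => ?_
    fin_cases j
    · simp only [e, Fin.zero_eta] at e0 ⊢
      linarith
    · simp only [e, Fin.mk_one] at e1 ⊢
      linarith
  have hl : ∑ c ∈ Finset.range (x.a + x.c + 1),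
      l c • triple F x.i (x.a + x.c - c) x.b c • η = 0 := by
    rw [← h1, ← Finset.sum_fiberwise_of_maps_to (t := Finset.range (x.a + x.c + 1))
      (g := fun y : CBIndex m n => y.c)]
    · refine Finset.sum_congr rfl fun c _ => ?_
      rw [Finset.sum_smul, Finset.filter_filter]
      refine Finset.sum_congr rfl fun y hy => ?_
      obtain ⟨hy', rfl⟩ := (Finset.mem_filter.mp hy).2
      obtain ⟨hi, hac, hb⟩ := hfam y hy'
      rw [← hi, ← hac, ← hb, Nat.add_sub_cancel]
    · intro y hy
      have := (hfam y (Finset.mem_filter.mp hy).2).2.1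
      rw [Finset.mem_range]
      omega
  have hx := hη.eq_zero_of_sum_triple (x.a + x.c + x.b) x.i (x.a + x.c) x.b x.add_le rfl l hl x.c
    (by omega) x.c_le x.le_add
  have hsingle : l x.c = g x := by
    refine Finset.sum_eq_single_of_mem x (by simp) fun y hy hne => ?_
    obtain ⟨hy, hc⟩ := (Finset.mem_filter.mp hy).2
    obtain ⟨hi, hac, hb⟩ := hfam y hy
    exact absurd (CBIndex.ext hi (by omega) hb hc) hne
  rw [← hsingle, hx]

end Independence

/-! ### Divided powers of `B_i` acting on monomials -/

@[simp] theorem qBinom_zero (x : ℤ) : qBinom x 0 = 1 := by simp [qBinom, qFactorial]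

theorem qBinom_succ (x : ℤ) (k : ℕ) :
    qBinom x (k + 1) = (qInt (k + 1))⁻¹ * (qInt x * qBinom (x - 1) k) := by
  rw [qBinom, qBinom, Finset.prod_range_succ', qFactorial_succ, div_eq_inv_mul, div_eq_inv_mul,
    mul_inv, Nat.cast_zero, sub_zero,
    Finset.prod_congr rfl fun (s : ℕ) (_ : s ∈ Finset.range k) =>
      (congrArg qInt (show x - ((s + 1 : ℕ) : ℤ) = x - 1 - s by push_cast; ring))]
  ring

theorem qBinom_eq_zero {x : ℤ} {k : ℕ} (h0 : 0 ≤ x) (hk : x < k) : qBinom x k = 0 := by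
  obtain ⟨s, rfl⟩ := Int.eq_ofNat_of_zero_le h0
  rw [qBinom, Finset.prod_eq_zero (i := s) (by simpa using hk) (by simp), zero_div]

/-- The summand `ς_i E_{τ i} K_i⁻¹` of `B_i`. -/
noncomputable def EKinv (ς : Fin 2 → 𝔽) (i : Fin 2) : U := ς i • (E (tau i) * Kinv i)

theorem BU_eq (ς : Fin 2 → 𝔽) (i : Fin 2) : BU ς i = F i + EKinv ς i := rfl

theorem EKinv_mul_F (ς : Fin 2 → 𝔽) (i : Fin 2) :
    EKinv ς i * F i = q ^ (2 : ℤ) • (F i * EKinv ς i) := by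
  have h := Kinv_mul_of_K_mul (K_mul_F i i)
  rw [cartan_self, neg_neg] at h
  rw [EKinv, smul_mul_assoc, mul_assoc, h, mul_smul_comm, ← mul_assoc, E_mul_F_of_ne (tau_ne i),
    mul_smul_comm, mul_assoc, smul_comm]

section Action

variable {V : Type*} [AddCommGroup V] [Module 𝔽 V] [Module U V] [IsScalarTower 𝔽 U V]
variable {x : Fin 2 → ℤ} {v : V}

theorem smul_mul_smul_vector (r : 𝔽) (a b : U) (w : V) : (r • (a * b)) • w = r • a • b • w := by
  rw [smul_assoc, mul_smul]

theorem EKinv_smul (ς : Fin 2 → 𝔽) (i : Fin 2) (hx : IsWeightVector x v) :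
    EKinv ς i • v = (ς i * q ^ (-x i)) • E (tau i) • v := by
  rw [EKinv, smul_assoc, mul_smul, hx.Kinv_smul, smul_comm (E _), smul_smul]

theorem dividedPow_EKinv_smul (ς : Fin 2 → 𝔽) (i : Fin 2) (hx : IsWeightVector x v)
    (hE : E (tau i) • v = 0) (b k : ℕ) :
    dividedPow (EKinv ς i) k • dividedPow (F (tau i)) (b + k) • v =
      (q ^ ((k.choose 2 : ℤ) - k * (x i + b + k)) * ς i ^ k * qBinom (x (tau i) - b) k) •
        dividedPow (F (tau i)) b • v := by
  induction k generalizing b with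
  | zero => simp
  | succ k ih =>
    rw [dividedPow_succ, smul_assoc, mul_smul, show b + (k + 1) = b + 1 + k by ring, ih,
      smul_comm (EKinv ς i), EKinv_smul ς i (hx.dividedPow_F_smul (tau i) (b + 1)),
      E_smul_dividedPow_succ_F_smul hx, hE, smul_zero, zero_add, cartan_ne (tau_ne i).symm,
      smul_smul, smul_smul, smul_smul, qBinom_succ]
    congr 1
    have e : (((k + 1).choose 2 : ℕ) : ℤ) - (k + 1 : ℕ) * (x i + b + (k + 1 : ℕ)) =
        (k.choose 2 : ℤ) - k * (x i + (b + 1 : ℕ) + k) + -(x i - (b + 1 : ℕ) * -1) := by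
      rw [Nat.choose_succ_succ' k 1, Nat.choose_one_right]
      push_cast
      ring
    rw [e, zpow_add₀ q_ne_zero, show x (tau i) - (b : ℤ) - 1 = x (tau i) - (b + 1 : ℕ) by
      push_cast; ring]
    ring

theorem dividedPow_EKinv_smul_eq_zero (ς : Fin 2 → 𝔽) (i : Fin 2) (hx : IsWeightVector x v)
    (hE : E (tau i) • v = 0) {b k : ℕ} (h : b < k) :
    dividedPow (EKinv ς i) k • dividedPow (F (tau i)) b • v = 0 := by
  induction k, h using Nat.le_induction with
  | base =>
    have h0 := dividedPow_EKinv_smul ς i hx hE 0 b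
    rw [zero_add, dividedPow_zero, one_smul] at h0
    rw [dividedPow_succ, smul_assoc, mul_smul, h0, smul_comm (EKinv ς i), EKinv_smul ς i hx, hE,
      smul_zero, smul_zero, smul_zero]
  | succ k _ ih => rw [dividedPow_succ, smul_assoc, mul_smul, ih, smul_zero, smul_zero]

theorem sum_range_eq_sum_range_reflect {M : Type*} [AddCommMonoid M] {f : ℕ → M} {N d : ℕ}
    (hf : ∀ k, N < k → k ≤ N + d → f k = 0) :
    ∑ k ∈ Finset.range (N + d + 1), f k = ∑ t ∈ Finset.range (N + 1), f (N - t) := by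
  rw [← Finset.sum_range_reflect (fun t => f (N - t))]
  refine ((Finset.sum_congr rfl fun k hk => ?_).trans
    (Finset.sum_subset ?_ fun k hk hk' => ?_)).symm
  · rw [Finset.mem_range] at hk
    rw [show N - (N + 1 - 1 - k) = k by omega]
  · exact Finset.range_subset_range.mpr (by omega)
  · rw [Finset.mem_range] at hk hk'
    exact hf k (by omega) (by omega)

/-- The action of divided powers of `B_i` on a monomial in `F_{τ i}`; either `B_i` or `F_{τ i}`
has the smaller exponent `N`. -/
theorem dividedPow_BU_smul (ς : Fin 2 → 𝔽) (i : Fin 2) (hx : IsWeightVector x v)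
    (hE : E (tau i) • v = 0) (N d d' : ℕ) (hd : d = 0 ∨ d' = 0) :
    dividedPow (BU ς i) (N + d) • dividedPow (F (tau i)) (N + d') • v =
      ∑ t ∈ Finset.range (N + 1),
        (q ^ (((N - t : ℕ) : ℤ) * (t + d) + ((N - t).choose 2 - (N - t : ℕ) * (x i + N + d'))) *
          ς i ^ (N - t) * qBinom (x (tau i) - (t + d')) (N - t)) •
        dividedPow (F i) (t + d) • dividedPow (F (tau i)) (t + d') • v := by
  rw [BU_eq, dividedPow_add (EKinv_mul_F ς i), Finset.sum_smul, sum_range_eq_sum_range_reflect]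
  · refine Finset.sum_congr rfl fun t ht => ?_
    obtain ⟨k, rfl⟩ := Nat.exists_eq_add_of_le (Nat.lt_succ_iff.mp (Finset.mem_range.mp ht))
    rw [smul_mul_smul_vector, show t + k + d' = t + d' + (t + k - t) by omega,
      dividedPow_EKinv_smul ς i hx hE, smul_comm (dividedPow (F i) _), smul_smul,
      show t + k + d - (t + k - t) = t + d by omega, show t + k - t = k by omega]
    congr 1
    rw [← mul_assoc, ← mul_assoc, ← zpow_add₀ q_ne_zero]
    push_cast
    congr 4
    · ring
    · ring
  · intro k hk hk'
    obtain rfl : d' = 0 := by omega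
    rw [smul_mul_smul_vector, dividedPow_EKinv_smul_eq_zero ς i hx hE (by omega), smul_zero,
      smul_zero]

/-- The inverse of `dividedPow_BU_smul`. -/
theorem dividedPow_F_smul_eq_sum_BU (ς : Fin 2 → 𝔽) (i : Fin 2) (hx : IsWeightVector x v)
    (hE : E (tau i) • v = 0) (N d d' : ℕ) (hd : d = 0 ∨ d' = 0) :
    dividedPow (F i) (N + d) • dividedPow (F (tau i)) (N + d') • v =
      ∑ t ∈ Finset.range (N + 1),
        ((-1) ^ (N - t) * (q ^ (((N - t : ℕ) : ℤ) * (N + d - 1) +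
            ((N - t).choose 2 - (N - t : ℕ) * (x i + N + d'))) *
          ς i ^ (N - t) * qBinom (x (tau i) - (t + d')) (N - t))) •
        dividedPow (BU ς i) (t + d) • dividedPow (F (tau i)) (t + d') • v := by
  rw [dividedPow_eq_sum_dividedPow_add (EKinv_mul_F ς i), ← BU_eq, Finset.sum_smul,
    sum_range_eq_sum_range_reflect]
  · refine Finset.sum_congr rfl fun t ht => ?_
    obtain ⟨k, rfl⟩ := Nat.exists_eq_add_of_le (Nat.lt_succ_iff.mp (Finset.mem_range.mp ht))
    rw [smul_mul_smul_vector, show t + k + d' = t + d' + (t + k - t) by omega,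
      dividedPow_EKinv_smul ς i hx hE, smul_comm (dividedPow (BU ς i) _), smul_smul,
      show t + k + d - (t + k - t) = t + d by omega, show t + k - t = k by omega]
    congr 1
    rw [← mul_assoc, ← mul_assoc, mul_assoc ((-1) ^ k), ← zpow_add₀ q_ne_zero, ← mul_assoc,
      ← mul_assoc]
    push_cast
    congr 5
    · ring
  · intro k hk hk'
    obtain rfl : d' = 0 := by omega
    rw [smul_mul_smul_vector, dividedPow_EKinv_smul_eq_zero ς i hx hE (by omega), smul_zero,
      smul_zero]

end Action

/-! ### The transition coefficients -/

/-- The coefficient of `F_i^(t) F_{τ i}^(t + l + r) F_i^(l) η` in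
`B_i^(a) B_{τ i}^(a + c + r) B_i^(c) η`, for `t ≤ a` and `l ≤ c`; here `m`, `n` are the coordinates
of the highest weight at `i`, `τ i`, and `s`, `s'` the parameters at `i`, `τ i`. -/
noncomputable def forwardCoeff (m n : ℕ) (s s' : 𝔽) (a c r t l : ℕ) : 𝔽 :=
  q ^ (((a - t : ℕ) : ℤ) * t + (a - t).choose 2 - (a - t : ℕ) * ((m : ℤ) - l + a + r) +
      (((c - l : ℕ) : ℤ) * (a + r + l) + (c - l).choose 2 - (c - l : ℕ) * ((n : ℤ) + c))) *
    s ^ (a - t) * s' ^ (c - l) *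
    qBinom ((n : ℤ) - r - t) (a - t) * qBinom ((m : ℤ) - l) (c - l)

theorem forwardCoeff_self (m n : ℕ) (s s' : 𝔽) (a c r : ℕ) :
    forwardCoeff m n s s' a c r a c = 1 := by
  simp [forwardCoeff]

/-- The symmetry behind the coincidence of the two families of `B`-monomials for `b = a + c`. -/
theorem forwardCoeff_swap (m n : ℕ) (s s' : 𝔽) {a c t l : ℕ} (ht : t ≤ a) (hl : l ≤ c) :
    forwardCoeff m n s s' a c 0 t l = forwardCoeff n m s' s c a 0 l t := by
  obtain ⟨k, rfl⟩ := Nat.exists_eq_add_of_le ht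
  obtain ⟨j, rfl⟩ := Nat.exists_eq_add_of_le hl
  rw [forwardCoeff, forwardCoeff, show t + k - t = k by omega, show l + j - l = j by omega]
  have e : (k : ℤ) * t + k.choose 2 - k * ((m : ℤ) - l + (t + k : ℕ) + (0 : ℕ)) +
        ((j : ℤ) * ((t + k : ℕ) + (0 : ℕ) + l) + j.choose 2 - j * ((n : ℤ) + (l + j : ℕ))) =
      (j : ℤ) * l + j.choose 2 - j * ((n : ℤ) - t + (l + j : ℕ) + (0 : ℕ)) +
        ((k : ℤ) * ((l + j : ℕ) + (0 : ℕ) + t) + k.choose 2 - k * ((m : ℤ) + (t + k : ℕ))) := by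
    push_cast
    ring
  rw [e, Nat.cast_zero, sub_zero, sub_zero]
  ring

/-- The coefficient of the inverse transition matrix as a product of the coefficients of two
applications of `dividedPow_F_smul_eq_sum_BU`. The halves in the exponent become binomial
coefficients, by `k (k - 1) / 2 = k.choose 2`. -/
theorem inverseCoeff_eq (m n : ℕ) (s s' : 𝔽) {a c r t l : ℕ} (ht : t ≤ a) (hl : l ≤ c) :
    inverseCoeff m n s s' a c r t l =
      (-1) ^ (a - t) * (q ^ (((a - t : ℕ) : ℤ) * (a - 1) +
          ((a - t).choose 2 - (a - t : ℕ) * ((m : ℤ) - 2 * c + a + (c + r)))) *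
        s ^ (a - t) * qBinom ((n : ℤ) - r - t) (a - t)) *
      ((-1) ^ (c - l) * (q ^ (((c - l : ℕ) : ℤ) * (c + (t + r) - 1) +
          ((c - l).choose 2 - (c - l : ℕ) * ((n : ℤ) + c))) *
        s' ^ (c - l) * qBinom ((m : ℤ) - l) (c - l))) := by
  obtain ⟨k, rfl⟩ := Nat.exists_eq_add_of_le ht
  obtain ⟨j, rfl⟩ := Nat.exists_eq_add_of_le hl
  rw [inverseCoeff, show t + k - t = k by omega, show l + j - l = j by omega]
  have hchoose : ∀ k : ℕ, (k : ℤ) * k = 2 * k.choose 2 + k := by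
    intro k
    induction k with
    | zero => simp
    | succ k ih =>
      rw [Nat.choose_succ_succ' k 1, Nat.choose_one_right]
      push_cast
      linear_combination ih
  have e1 : (((t + k : ℕ) : ℤ) - t) * (-2 * m - 3 - 2 * r + 2 * l + (t + k : ℕ) - t) / 2 =
      k.choose 2 - k * (m + 1 + r - l) := by
    refine Int.ediv_eq_of_eq_mul_right two_ne_zero ?_
    push_cast
    linear_combination hchoose k
  have e2 : (((l + j : ℕ) : ℤ) - l) *
      (-2 * n - 3 + 2 * r + 2 * (t + k : ℕ) + (l + j : ℕ) - l) / 2 =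
      j.choose 2 - j * (n + 1 - r - (t + k)) := by
    refine Int.ediv_eq_of_eq_mul_right two_ne_zero ?_
    push_cast
    linear_combination hchoose j
  rw [e1, e2, show (k.choose 2 : ℤ) - k * (m + 1 + r - l) + (j.choose 2 - j * (n + 1 - r - (t + k)))
    = (k * ((t + k : ℕ) - 1) + (k.choose 2 - k * (m - 2 * (l + j : ℕ) + (t + k : ℕ) +
        ((l + j : ℕ) + r)))) + (j * ((l + j : ℕ) + (t + r) - 1) +
        (j.choose 2 - j * (n + (l + j : ℕ)))) by push_cast; ring, zpow_add₀ q_ne_zero, pow_add]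
  ring

theorem triple_B_smul {V : Type*} [AddCommGroup V] [Module U V] (ς : Fin 2 → 𝔽) (i : Fin 2)
    (a b c : ℕ) (v : V) :
    triple (B ς) i a b c • v = triple (BU ς) i a b c • v := by
  have h := fun (i : Fin 2) (k : ℕ) => map_dividedPow (iU ς).val (B ς i) k
  have h' : (iU ς).val (triple (B ς) i a b c) = triple (BU ς) i a b c := by
    rw [triple, map_mul, map_mul, h, h, h]
    rfl
  exact congrArg (· • v) h'

section Transition

variable {V : Type*} [AddCommGroup V] [Module 𝔽 V] [Module U V] [IsScalarTower 𝔽 U V]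
variable {m n : ℕ} {η : V}

/-- The summand `ς_i E_{τ i} K_i⁻¹` of `B_i` kills all `F_i^(k) η`. -/
theorem IsHighestWeightVector.dividedPow_BU_smul_self (hη : IsHighestWeightVector m n η)
    (ς : Fin 2 → 𝔽) (i : Fin 2) (c : ℕ) :
    dividedPow (BU ς i) c • η = dividedPow (F i) c • η := by
  simpa using dividedPow_BU_smul ς i hη.isWeightVector (hη.E_smul _) 0 c 0 (Or.inr rfl)

/-- The `B`-monomials in terms of the `F`-monomials: `dividedPow_BU_smul` is applied to the middle
factor and then to the left factor. -/
theorem IsHighestWeightVector.triple_BU_smul (hη : IsHighestWeightVector m n η)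
    (ς : Fin 2 → 𝔽) (i : Fin 2) (a c r : ℕ) :
    triple (BU ς) i a (a + c + r) c • η =
      ∑ t ∈ Finset.range (a + 1), ∑ l ∈ Finset.range (c + 1),
        forwardCoeff (wt m n i) (wt m n (tau i)) (ς i) (ς (tau i)) a c r t l •
          triple F i t (t + l + r) l • η := by
  have h1 := dividedPow_BU_smul ς (tau i) hη.isWeightVector (hη.E_smul _) c (a + r) 0
    (Or.inr rfl)
  rw [tau_tau, add_zero] at h1
  rw [triple_smul, hη.dividedPow_BU_smul_self, show a + c + r = c + (a + r) by ring, h1,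
    Finset.smul_sum, Finset.sum_comm]
  refine Finset.sum_congr rfl fun l _ => ?_
  have h2 := dividedPow_BU_smul ς i (hη.isWeightVector.dividedPow_F_smul i l)
    (hη.E_tau_smul_dividedPow i l) a 0 (l + r) (Or.inl rfl)
  rw [add_zero, show a + (l + r) = l + (a + r) by ring] at h2
  rw [add_zero, smul_comm (dividedPow (BU ς i) a), h2, Finset.smul_sum]
  refine Finset.sum_congr rfl fun t _ => ?_
  rw [smul_smul, triple_smul, add_zero, add_assoc t l r]
  congr 1
  rw [forwardCoeff, cartan_self, cartan_ne (tau_ne i), zpow_add₀ q_ne_zero (_ - _ * _)]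
  push_cast
  have e1 : (wt m n i : ℤ) - (l + 0) = wt m n i - l := by ring
  have e2 : (wt m n (tau i) : ℤ) - l * -1 - (t + (l + r)) = wt m n (tau i) - r - t := by ring
  rw [e1, e2, add_zero, add_zero, add_comm (l : ℤ) (a + r), ← add_sub_assoc, ← add_sub_assoc,
    show (wt m n i : ℤ) - l * 2 + a + (l + r) = wt m n i - l + a + r by ring]
  ring

/-- The `F`-monomials in terms of the `B`-monomials: `dividedPow_F_smul_eq_sum_BU` is applied to the
left factor and then to the middle factor. -/
theorem IsHighestWeightVector.triple_F_smul (hη : IsHighestWeightVector m n η)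
    (ς : Fin 2 → 𝔽) (i : Fin 2) (a c r : ℕ) :
    triple F i a (a + c + r) c • η =
      ∑ t ∈ Finset.range (a + 1), ∑ l ∈ Finset.range (c + 1),
        inverseCoeff (wt m n i) (wt m n (tau i)) (ς i) (ς (tau i)) a c r t l •
          triple (BU ς) i t (t + l + r) l • η := by
  have h1 := dividedPow_F_smul_eq_sum_BU ς i (hη.isWeightVector.dividedPow_F_smul i c)
    (hη.E_tau_smul_dividedPow i c) a 0 (c + r) (Or.inl rfl)
  rw [add_zero] at h1
  rw [triple_smul, show a + c + r = a + (c + r) by ring, h1]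
  refine Finset.sum_congr rfl fun t ht => ?_
  have h2 := dividedPow_F_smul_eq_sum_BU ς (tau i) hη.isWeightVector (hη.E_smul _) c (t + r) 0
    (Or.inr rfl)
  rw [tau_tau, add_zero] at h2
  rw [show t + (c + r) = c + (t + r) by ring, h2, Finset.smul_sum, Finset.smul_sum]
  refine Finset.sum_congr rfl fun l hl => ?_
  rw [add_zero, smul_comm (dividedPow (BU ς i) _), smul_smul, triple_smul,
    hη.dividedPow_BU_smul_self, add_zero, show t + l + r = l + (t + r) by ring,
    inverseCoeff_eq _ _ _ _ (Nat.lt_succ_iff.mp (Finset.mem_range.mp ht))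
      (Nat.lt_succ_iff.mp (Finset.mem_range.mp hl))]
  congr 1
  rw [cartan_self, cartan_ne (tau_ne i)]
  push_cast
  have e1 : (wt m n i : ℤ) - (l + 0) = wt m n i - l := by ring
  have e2 : (wt m n (tau i) : ℤ) - c * -1 - (t + (c + r)) = wt m n (tau i) - r - t := by ring
  rw [e1, e2, add_zero, add_zero, mul_comm (c : ℤ) 2]

theorem IsHighestWeightVector.triple_BU_eq (hη : IsHighestWeightVector m n η)
    (ς : Fin 2 → 𝔽) (i : Fin 2) (a c : ℕ) :
    triple (BU ς) i a (a + c) c • η = triple (BU ς) (tau i) c (a + c) a • η := by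
  have h1 := hη.triple_BU_smul ς i a c 0
  have h2 := hη.triple_BU_smul ς (tau i) c a 0
  rw [add_zero] at h1 h2
  rw [h1, add_comm a c, h2, Finset.sum_comm]
  refine Finset.sum_congr rfl fun l hl => Finset.sum_congr rfl fun t ht => ?_
  rw [tau_tau, forwardCoeff_swap _ _ _ _ (Nat.lt_succ_iff.mp (Finset.mem_range.mp ht))
      (Nat.lt_succ_iff.mp (Finset.mem_range.mp hl)), add_zero, add_zero, triple_F_eq, add_comm l t]

/-- In the expansion of such a vector, each term has a vanishing `F`-monomial or a vanishing quantum
binomial coefficient. -/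
theorem IsHighestWeightVector.triple_BU_smul_eq_zero [IsSimpleModule U V]
    (hη : IsHighestWeightVector m n η) (ς : Fin 2 → 𝔽) (i : Fin 2) {a b c : ℕ} (hab : a + c ≤ b)
    (h : c ≤ wt m n i → c + wt m n (tau i) < b) : triple (BU ς) i a b c • η = 0 := by
  by_cases hc : c ≤ wt m n i
  · obtain ⟨r, rfl⟩ := Nat.exists_eq_add_of_le hab
    rw [hη.triple_BU_smul]
    refine Finset.sum_eq_zero fun t ht => Finset.sum_eq_zero fun l hl => ?_
    rw [Finset.mem_range] at ht hl
    have hb := h hc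
    by_cases htr : t + r ≤ wt m n (tau i)
    · rw [forwardCoeff, qBinom_eq_zero (x := (wt m n (tau i) : ℤ) - r - t) (by omega) (by omega),
        mul_zero, zero_mul, zero_smul]
    · rw [hη.triple_F_smul_eq_zero i (fun _ => by omega), smul_zero]
  · rw [triple_smul, hη.dividedPow_BU_smul_self, hη.dividedPow_eq_zero i c (by omega), smul_zero,
      smul_zero]

theorem IsHighestWeightVector.triple_BU_sub_mem_span (hη : IsHighestWeightVector m n η)
    (ς : Fin 2 → 𝔽) (x : CBIndex m n) :
    triple (BU ς) x.i x.a x.b x.c • η - triple F x.i x.a x.b x.c • η ∈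
      Submodule.span 𝔽 ((fun y : CBIndex m n => triple F y.i y.a y.b y.c • η) '' {y | y < x}) := by
  obtain ⟨i, a, b, c, h1, h2, h3, h4⟩ := x
  obtain ⟨r, rfl⟩ := Nat.exists_eq_add_of_le h2
  dsimp only
  rw [hη.triple_BU_smul, ← Finset.sum_product']
  rw [← Finset.add_sum_erase _ _ (a := (a, c)) (by simp)]
  rw [forwardCoeff_self, one_smul, add_sub_cancel_left]
  refine Submodule.sum_mem _ fun y hy => Submodule.smul_mem _ _ (Submodule.subset_span ?_)
  obtain ⟨t, l⟩ := y
  simp only [Finset.mem_erase, Finset.mem_product, Finset.mem_range, ne_eq, Prod.mk.injEq] at hy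
  dsimp only
  refine ⟨⟨i, t, t + l + r, l, by omega, by omega, by omega, fun hi => ?_⟩, ?_, rfl⟩
  · have := h4 hi
    omega
  · change (_ : CBIndex m n) < _
    refine lt_of_le_of_ne (show _ ∧ _ ∧ _ ∧ _ from ⟨rfl, ?_, ?_, ?_⟩) fun h => ?_
    · dsimp only
      omega
    · dsimp only
      omega
    · dsimp only
      omega
    · simp only [CBIndex.mk.injEq] at h
      omega

end Transition

/-! ### The two bases of the simple module -/

/-- A family that differs unitriangularly from a finite basis is a basis, and the matrix of the
change of basis is unitriangular. -/
theorem exists_basis_of_unitriangular {ι k W : Type*} [Finite ι] [PartialOrder ι] [Field k]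
    [AddCommGroup W] [Module k W] (b : Module.Basis ι k W) (v : ι → W)
    (h : ∀ x, v x - b x ∈ Submodule.span k (b '' {y | y < x})) :
    ∃ b' : Module.Basis ι k W, (∀ x, b' x = v x) ∧ (∀ x, b.toMatrix b' x x = 1) ∧
      ∀ x y, b.toMatrix b' y x ≠ 0 → y ≤ x := by
  classical
  have := Fintype.ofFinite ι
  have hmem : ∀ x, b x ∈ Submodule.span k (Set.range v) := by
    intro x
    induction x using WellFoundedLT.induction with
    | ind x ih =>
      have hle : Submodule.span k (b '' {y | y < x}) ≤ Submodule.span k (Set.range v) := by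
        refine Submodule.span_le.mpr ?_
        rintro _ ⟨y, hy, rfl⟩
        exact ih y hy
      rw [← sub_sub_cancel (v x) (b x)]
      exact Submodule.sub_mem _ (Submodule.subset_span ⟨x, rfl⟩) (hle (h x))
  have hspan : ⊤ ≤ Submodule.span k (Set.range v) := by
    rw [← b.span_eq, Submodule.span_le]
    rintro _ ⟨x, rfl⟩
    exact hmem x
  let b' := basisOfTopLeSpanOfCardEqFinrank v hspan (Module.finrank_eq_card_basis b).symm
  have hb' : ∀ x, b' x = v x := fun x => by
    rw [coe_basisOfTopLeSpanOfCardEqFinrank]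
  have hmat : ∀ x y, ¬ y < x → b.toMatrix b' y x = if x = y then 1 else 0 := by
    intro x y hy
    have h1 := b.mem_span_image.mp (h x)
    have h2 : b.repr (v x - b x) y = 0 := by
      by_contra hne
      exact hy (h1 (Finsupp.mem_support_iff.mpr hne))
    rw [map_sub, Finsupp.sub_apply, sub_eq_zero] at h2
    rw [Module.Basis.toMatrix_apply, hb', h2, b.repr_self, Finsupp.single_apply]
  refine ⟨b', hb', fun x => by rw [hmat x x (lt_irrefl x), if_pos rfl], fun x y hne => ?_⟩
  by_contra hle
  refine hne ?_
  rw [hmat x y fun hlt => hle hlt.le, if_neg]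
  rintro rfl
  exact hle le_rfl

section Index

variable {V : Type*} [AddCommGroup V] [Module U V] {m n : ℕ} {η : V}

theorem range_eq_quasiICanonicalSet (ς : Fin 2 → 𝔽)
    (h : ∀ a c : ℕ, triple (B ς) 0 a (a + c) c • η = triple (B ς) 1 c (a + c) a • η) :
    (Set.range fun x : CBIndex m n => triple (B ς) x.i x.a x.b x.c • η) =
      quasiICanonicalSet ς m n η := by
  ext v
  constructor
  · rintro ⟨⟨i, a, b, c, h1, h2, h3, h4⟩, rfl⟩
    fin_cases i
    · exact Or.inl ⟨a, b, c, h1, h2, h3, rfl⟩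
    · exact Or.inr ⟨c, b, a, h1, by omega, h3, rfl⟩
  · rintro (⟨a, b, c, h1, h2, h3, rfl⟩ | ⟨a, b, c, h1, h2, h3, rfl⟩)
    · exact ⟨⟨0, a, b, c, h1, h2, h3, by simp⟩, rfl⟩
    · by_cases hb : b = a + c
      · subst hb
        refine ⟨⟨0, a, a + c, c, ?_, le_rfl, ?_, by simp⟩, h a c⟩
        · change c ≤ m
          omega
        · change a + c ≤ c + n
          omega
      · exact ⟨⟨1, c, b, a, h1, by omega, h3, by omega⟩, rfl⟩

end Index

section Main

variable {V : Type*} [AddCommGroup V] [Module 𝔽 V] [Module U V] [IsScalarTower 𝔽 U V]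
variable {m n : ℕ} {η : V}

theorem IsHighestWeightVector.range_eq_canonicalBasis [IsSimpleModule U V]
    (hη : IsHighestWeightVector m n η) :
    (Set.range fun x : CBIndex m n => triple F x.i x.a x.b x.c • η) = canonicalBasis η := by
  ext v
  constructor
  · rintro ⟨x, rfl⟩
    exact ⟨hη.linearIndependent.ne_zero x, _, ⟨x.i, x.a, x.b, x.c, x.add_le, rfl⟩, rfl⟩
  · rintro ⟨hv, _, ⟨i, a, b, c, h, rfl⟩, rfl⟩
    obtain ⟨x, hx⟩ := (hη.triple_F_smul_eq_zero_or_exists i a b c h).resolve_left hv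
    exact ⟨x, by beta_reduce; rw [hx]⟩

end Main

end QSL3

open QSL3 in
theorem mainTheorem6 (m n : ℕ) (ς : Fin 2 → 𝔽)
    {V : Type*} [AddCommGroup V] [Module 𝔽 V] [Module U V] [IsScalarTower 𝔽 U V]
    [IsSimpleModule U V] (η : V) (hη : IsHighestWeightVector m n η) :
    -- vanishing
    (∀ a b c : ℕ, a + c ≤ b →
      (triple (B ς) 0 a b c • η = 0 ↔ triple F 0 a b c • η = 0)) ∧
    -- the identification of the two families for `b = a + c`
    (∀ a c : ℕ, triple (B ς) 0 a (a + c) c • η = triple (B ς) 1 c (a + c) a • η) ∧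
    -- the quasi icanonical basis `bB`, the canonical basis `bF`, with the same index set
    (∃ bB bF : Module.Basis (CBIndex m n) 𝔽 V,
      (∀ x, bB x = triple (B ς) x.i x.a x.b x.c • η) ∧
      (∀ x, bF x = triple F x.i x.a x.b x.c • η) ∧
      Set.range bB = quasiICanonicalSet ς m n η ∧
      Set.range bF = canonicalBasis η ∧
      -- the transition matrix is unitriangular
      (∀ x, bF.toMatrix bB x x = 1) ∧
      (∀ x y, bF.toMatrix bB y x ≠ 0 → y ≤ x)) ∧
    -- the inverse transition matrix
    (∀ (i : Fin 2) (a c r : ℕ),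
      triple F i a (a + c + r) c • η =
        ∑ t ∈ Finset.range (a + 1), ∑ l ∈ Finset.range (c + 1),
          inverseCoeff (wt m n i) (wt m n (tau i)) (ς i) (ς (tau i)) a c r t l •
            triple (B ς) i t (t + l + r) l • η) := by
  have hswap : ∀ a c : ℕ, triple (B ς) 0 a (a + c) c • η = triple (B ς) 1 c (a + c) a • η :=
    fun a c => by
      rw [triple_B_smul, triple_B_smul]
      exact hη.triple_BU_eq ς 0 a c
  let bF : Module.Basis (CBIndex m n) 𝔽 V :=
    Module.Basis.mk hη.linearIndependent hη.span_eq_top.ge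
  have hbF : ⇑bF = fun x : CBIndex m n => triple F x.i x.a x.b x.c • η := Module.Basis.coe_mk _ _
  obtain ⟨bB, hbB, hdiag, htri⟩ := exists_basis_of_unitriangular bF
    (fun x => triple (BU ς) x.i x.a x.b x.c • η) (fun x => by
      rw [hbF]
      exact hη.triple_BU_sub_mem_span ς x)
  have hbB' : ∀ x, bB x = triple (B ς) x.i x.a x.b x.c • η := fun x => by
    rw [hbB, triple_B_smul]
  refine ⟨fun a b c hab => ?_, hswap, ⟨bB, bF, hbB', congrFun hbF, ?_, ?_, hdiag, htri⟩,
    fun i a c r => ?_⟩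
  · rw [triple_B_smul]
    by_cases hidx : c ≤ wt m n 0 ∧ b ≤ c + wt m n (tau 0)
    · let x : CBIndex m n := ⟨0, a, b, c, hidx.1, hab, hidx.2, by simp⟩
      refine iff_of_false ?_ (hη.linearIndependent.ne_zero x)
      have := bB.ne_zero x
      rwa [hbB] at this
    · exact iff_of_true (hη.triple_BU_smul_eq_zero ς 0 hab (by omega))
        (hη.triple_F_smul_eq_zero 0 (by omega))
  · rw [← range_eq_quasiICanonicalSet ς hswap]
    exact congrArg Set.range (funext hbB')
  · rw [hbF, hη.range_eq_canonicalBasis]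
  · simp only [triple_B_smul]
    exact hη.triple_F_smul ς i a c r
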